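/- All trees are nonempty finite rooted trees; a forest is a finite (possibly empty) set of trees. A \emph{subforest} of a forest is a subset of its set of trees. A \emph{family of trees} $\mathfrak X$ consists of a class $\mathrm{Tree}(\mathfrak X)$ of trees with additional structure and a class $\mathrm{Forest}(\mathfrak X)$ of forests with additional structure, both considered up to isomorphism and having underlying trees and forests, with the following operations, compatible with isomorphisms: $\mathrm{DelRoot}:\mathrm{Tree}(\mathfrak X)\to\mathrm{Forest}(\mathfrak X)$, which deletes the root of the underlying tree; $\mathrm{Nodes}$, which sends $t$ to the set of nodes of its underlying tree; a restriction $V\mapsto V|U\in\mathrm{Forest}(\mathfrak X)$ for $V\in\mathrm{Forest}(\mathfrak X)$ and $U\subseteq V$ a subforest; and an attachment $t\leftharpoonup_d U\in\mathrm{Tree}(\mathfrak X)$ for $t\in\mathrm{Tree}(\mathfrak X)$, $U\in\mathrm{Forest}(\mathfrak X)$ and a map $d$ from the set of trees of $U$ to $\mathrm{Nodes}(t)$. They satisfy the following laws. (1) Every finite rooted tree (forest) underlies some element of $\mathrm{Tree}(\mathfrak X)$ (of $\mathrm{Forest}(\mathfrak X)$). (2) $V|V=V$. (3) The underlying forest of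 $V|U$ is $U$. (4) $W|U=(W|V)|U$ for subforests $U\subseteq V\subseteq W$. (5) The underlying tree of $t\leftharpoonup_d U$ is formed by linking the root of each tree $u$ of $U$ to the node $d(u)$ of $t$. (6) There are a unique $e\in\mathrm{Tree}(\mathfrak X)$ with exactly one node and a unique $\emptyset\in\mathrm{Forest}(\mathfrak X)$ whose underlying forest is empty. (7) $t=e\leftharpoonup\mathrm{DelRoot}(t)$, $t=t\leftharpoonup\emptyset$ and $U=\mathrm{DelRoot}(e\leftharpoonup U)$, with the only possible link maps. (8) For $d:\mathrm{DelRoot}(t_1)\to\mathrm{Nodes}(t_2)$ and $h:\mathrm{DelRoot}(t_2\leftharpoonup_d\mathrm{DelRoot}(t_1))\to\mathrm{Nodes}(t_3)$, $$t_3\leftharpoonup_h\mathrm{DelRoot}(t_2\leftharpoonup_d\mathrm{DelRoot}(t_1))=(t_3\leftharpoonup_f\mathrm{DelRoot}(t_2))\leftharpoonup_g\mathrm{DelRoot}(t_1),$$ where $f(s)=h(s')$ for $s'$ the tree of $\mathrm{DelRoot}(t_2\leftharpoonup_d\mathrm{DelRoot}(t_1))$ that contains $s$, and $g(s)=h(s)$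 if $d(s)=\mathrm{root}(t_2)$, $g(s)=d(s)$ otherwise. (9) For $d:X\to\mathrm{Nodes}(t)$ and a subforest $U$ of $\mathrm{DelRoot}(t\leftharpoonup_d X)$, let $V$ be the subforest of those trees of $\mathrm{DelRoot}(t)$, and $W$ that of those trees of $X$, whose nodes are nodes of $U$. Then $$e\leftharpoonup(\mathrm{DelRoot}(t\leftharpoonup_d X)|U)=(e\leftharpoonup(\mathrm{DelRoot}(t)|V))\leftharpoonup_{d}(X|W),$$ where $\mathrm{root}(t)$ is identified with the node of $e$. Let $k$ be a field of characteristic $0$. The $k$-algebra $k\{\mathfrak X\}$ has as basis the (isomorphism classes of) trees in $\mathrm{Tree}(\mathfrak X)$, unit $e$, and product $$t_1\cdot t_2=\sum_{d}\ t_2\leftharpoonup_d\mathrm{DelRoot}(t_1),$$ over all maps $d$ from the set of trees of $\mathrm{DelRoot}(t_1)$ to $\mathrm{Nodes}(t_2)$. Let $t_1\odot t_2=t_2\leftharpoonup_{d_0}\mathrm{DelRoot}(t_1)$, where $d_0$ is constant with value $\mathrm{root}(t_2)$. A tree $t\neq e$ is \emph{indecomposable} if $t=t_1\odot t_2$ implies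 $t_1=e$ or $t_2=e$; let $I(\mathfrak X)$ be the set of (isomorphism classes of) indecomposable trees. $\mathfrak X$ has the \emph{unique decomposition property} if $x_1\odot\cdots\odot x_p=y_1\odot\cdots\odot y_q$ with all $x_i,y_j\in I(\mathfrak X)$ implies that the sequences $(x_1,\dots,x_p)$ and $(y_1,\dots,y_q)$ are equal. \textbf{Theorem.} (a) If $\mathfrak X$ has the unique decomposition property, then the algebra homomorphism $k\langle I(\mathfrak X)\rangle\to k\{\mathfrak X\}$ from the free associative algebra which is the identity on $I(\mathfrak X)$ is an isomorphism. In particular $k\{\mathfrak X\}\cong k\langle I(\mathfrak X)\rangle$ as $k$-algebras. (b) The following families of trees have the unique decomposition property, so that (a) applies to them. (i) Ordered trees: trees with a total order on the set of children of each node; forests carry in addition a total order on their set of trees. In $t\leftharpoonup_d U$ the children newly linked to a node follow its original children. (ii) Heap-ordered trees: trees and forests with a total order on the set of all nodes such that each node precedes its children. In $t\leftharpoonup_d U$ the nodes of $U$ follow the nodes of $t$. (iii) $n$-generation ordered trees, for each $n\ge 2$: trees and forests with, for each node $\alpha$, a total order on the set $X_\alpha$ of the first $n$ generations of $\alpha$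 (the first generation is $\{\alpha\}$, and each next one consists of the children of the previous one), these orders agreeing on intersections, such that $\alpha$ precedes all other elements of $X_\alpha$; forests carry in addition a total order, agreeing with the others on intersections, on the set $Y$ of the first $n-1$ generations of the roots. In $t\leftharpoonup_d U$, for $\alpha$ a node of $t$, the nodes of $t$ in $X_\alpha$ precede those of $U$, which are ordered as in the set $Y$ of $U$. In (i)-(iii), nodes of $t$ among themselves and nodes of $U$ among themselves keep their order in $t\leftharpoonup_d U$, and $\mathrm{DelRoot}(t)$ and $V|U$ carry the induced orders. -/

import Mathlib

universe u v

namespace RootedTrees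

open scoped Classical

/-- A finite rooted forest, whose nodes are named by natural numbers. `parent v = some p` says that
the node `p` is the parent of the node `v`; roots, and natural numbers which are not nodes, have
no parent. The names carry no information: everything below is considered up to renaming, that
is, up to the action of `Equiv.Perm ℕ`. -/
@[ext]
structure RForest where
  nodes : Finset ℕ
  parent : ℕ → Option ℕ
  mem_of_parent : ∀ {v p : ℕ}, parent v = some p → v ∈ nodes ∧ p ∈ nodes
  wf : WellFounded fun p v : ℕ => parent v = some p

namespace RForest

/-- The roots of the trees of the forest. A tree of the forest is identified with its root. -/
def roots (F : RForest) : Finset ℕ := F.nodes.filter fun v => F.parent v = none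

theorem mem_roots {F : RForest} {v : ℕ} : v ∈ F.roots ↔ v ∈ F.nodes ∧ F.parent v = none := by
  simp [roots]

/-- Renaming the nodes of a forest. -/
instance : SMul (Equiv.Perm ℕ) RForest where
  smul σ F :=
    { nodes := F.nodes.map σ.toEmbedding
      parent := fun v => (F.parent (σ.symm v)).map σ
      mem_of_parent := by
        intro v p h
        obtain ⟨q, hq, rfl⟩ := Option.map_eq_some_iff.1 h
        have := F.mem_of_parent hq
        simp [this.1, this.2]
      wf := by
        refine Subrelation.wf ?_ (InvImage.wf σ.symm F.wf)
        intro p v h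
        obtain ⟨q, hq, rfl⟩ := Option.map_eq_some_iff.1 h
        simpa [InvImage] using hq }

theorem nodes_smul (σ : Equiv.Perm ℕ) (F : RForest) :
    (σ • F).nodes = F.nodes.map σ.toEmbedding := rfl

theorem parent_smul (σ : Equiv.Perm ℕ) (F : RForest) (v : ℕ) :
    (σ • F).parent v = (F.parent (σ.symm v)).map σ := rfl

instance : MulAction (Equiv.Perm ℕ) RForest where
  one_smul F := by
    ext1
    · simp [nodes_smul, Equiv.Perm.one_def]
    · funext v
      simp [parent_smul, Equiv.Perm.one_def]
  mul_smul σ τ F := by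
    ext1
    · ext a
      simp only [nodes_smul, Finset.mem_map_equiv]
      simp [Equiv.Perm.mul_def]
    · funext v
      simp [parent_smul, Equiv.Perm.mul_def, Function.comp_def]

/-- The empty forest. -/
def empty : RForest where
  nodes := ∅
  parent := fun _ => none
  mem_of_parent := by simp
  wf := ⟨fun a => ⟨a, by simp⟩⟩

/-- `S` is the set of nodes of a subforest of `F` (a set of trees of `F`): it contains a node if and
only if it contains its parent. -/
def IsSubforest (F : RForest) (S : Finset ℕ) : Prop :=
  S ⊆ F.nodes ∧ ∀ v p : ℕ, F.parent v = some p → (v ∈ S ↔ p ∈ S)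

/-- The subforest of `F` with set of nodes `S`. -/
def restrict (F : RForest) (S : Finset ℕ) (hS : F.IsSubforest S) : RForest where
  nodes := S
  parent := fun v => if v ∈ S then F.parent v else none
  mem_of_parent := by
    intro v p h
    have := hS.2 v p
    grind
  wf := by
    refine Subrelation.wf ?_ F.wf
    intro p v h
    grind

end RForest

/-- A finite rooted tree: a finite rooted forest with exactly one root. -/
@[ext]
structure RTree extends RForest where
  root : ℕ
  roots_eq : toRForest.roots = {root}

namespace RTree

theorem parent_eq_none {t : RTree} {v : ℕ} (hv : v ∈ t.nodes) : t.parent v = none ↔ v = t.root := by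
  have := t.roots_eq
  simp [Finset.ext_iff, RForest.mem_roots] at this
  grind

theorem root_mem (t : RTree) : t.root ∈ t.nodes := by
  have := t.roots_eq
  simp [Finset.ext_iff, RForest.mem_roots] at this
  grind

theorem parent_root (t : RTree) : t.parent t.root = none :=
  (parent_eq_none t.root_mem).2 rfl

theorem ext' {t s : RTree} (h : t.toRForest = s.toRForest) : t = s := by
  have h1 := t.roots_eq
  have h2 := s.roots_eq
  rw [h, h2] at h1
  exact RTree.ext (by rw [h]) (by rw [h]) (by simpa using h1.symm)

/-- Renaming the nodes of a tree. -/
instance : SMul (Equiv.Perm ℕ) RTree where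
  smul σ t :=
    { toRForest := σ • t.toRForest
      root := σ t.root
      roots_eq := by
        have := t.roots_eq
        simp only [Finset.ext_iff, RForest.mem_roots, Finset.mem_singleton] at this
        ext v
        have h := this (σ.symm v)
        simp only [RForest.mem_roots, RForest.nodes_smul, RForest.parent_smul,
          Finset.mem_map_equiv, Option.map_eq_none_iff, Finset.mem_singleton]
        rw [h, Equiv.symm_apply_eq] }

theorem toRForest_smul (σ : Equiv.Perm ℕ) (t : RTree) :
    (σ • t).toRForest = σ • t.toRForest := rfl

theorem root_smul (σ : Equiv.Perm ℕ) (t : RTree) : (σ • t).root = σ t.root := rfl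

instance : MulAction (Equiv.Perm ℕ) RTree where
  one_smul t := ext' (one_smul _ t.toRForest)
  mul_smul σ τ t := ext' (mul_smul σ τ t.toRForest)

/-- The tree with the single node `r`. -/
def single (r : ℕ) : RTree where
  nodes := {r}
  parent := fun _ => none
  mem_of_parent := by simp
  wf := ⟨fun a => ⟨a, by simp⟩⟩
  root := r
  roots_eq := by ext v; simp [RForest.mem_roots]

/-- The forest formed by deleting the root of a tree. -/
def delRoot (t : RTree) : RForest where
  nodes := t.nodes.erase t.root
  parent := fun v => if t.parent v = some t.root then none else t.parent v
  mem_of_parent := by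
    intro v p h
    have h1 := t.parent_root
    have h2 := @t.mem_of_parent v p
    grind
  wf := by
    refine Subrelation.wf ?_ t.wf
    intro p v h
    grind

/-- `t` and `U` have no node name in common and `d` maps the trees of the forest `U` (given by their
roots) to nodes of `t`. The values of `d` elsewhere are irrelevant. -/
def IsLink (t : RTree) (U : RForest) (d : ℕ → ℕ) : Prop :=
  Disjoint t.nodes U.nodes ∧ ∀ v ∈ U.roots, d v ∈ t.nodes

/-- The tree formed by linking the root `v` of each tree of `U` to the node `d v` of `t`. -/
def attach (t : RTree) (U : RForest) (d : ℕ → ℕ) (h : t.IsLink U d) : RTree where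
  nodes := t.nodes ∪ U.nodes
  parent := fun v =>
    if v ∈ t.nodes then t.parent v else if v ∈ U.roots then some (d v) else U.parent v
  mem_of_parent := by
    intro v p hp
    have h1 := @t.mem_of_parent v p
    have h2 := @U.mem_of_parent v p
    have h3 := h.2 v
    have h4 := @RForest.mem_roots U v
    grind
  wf := by
    have ht : ∀ v ∈ t.nodes, Acc (fun p v : ℕ =>
        (if v ∈ t.nodes then t.parent v else if v ∈ U.roots then some (d v) else U.parent v) =
          some p) v := by
      intro v
      induction v using t.wf.induction with
      | _ v ih =>
        intro hv
        refine ⟨_, fun p hp => ?_⟩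
        rw [if_pos hv] at hp
        exact ih p hp (t.mem_of_parent hp).2
    refine ⟨fun v => ?_⟩
    induction v using U.wf.induction with
    | _ v ih =>
      refine ⟨_, fun p hp => ?_⟩
      have h2 := @t.mem_of_parent v p
      by_cases hv : v ∈ t.nodes
      · rw [if_pos hv] at hp
        exact ht p (t.mem_of_parent hp).2
      · rw [if_neg hv] at hp
        by_cases hr : v ∈ U.roots
        · rw [if_pos hr] at hp
          exact ht p (by have := h.2 v hr; grind)
        · rw [if_neg hr] at hp
          exact ih p hp
  root := t.root
  roots_eq := by
    ext v
    have h1 := @t.parent_eq_none v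
    have h2 := t.root_mem
    have h4 := @RForest.mem_roots U v
    simp only [RForest.mem_roots, Finset.mem_union, Finset.mem_singleton]
    grind

end RTree

/-- The data of a family of trees: trees and forests with additional structure, on node sets named
by natural numbers, so that permutations of `ℕ` act on them by renaming; their underlying trees
and forests; and the operations: deleting the root, restriction of a forest to a subforest (given
by its set of nodes) and attachment of a forest to a tree along a map `d`. The nodes of a tree
are those of its underlying tree. The value of `restrict` is meaningful only on subforests and
that of `attach` only on link maps; nothing is required of the other values. -/
structure FamilyData where
  Tree : Type u
  Forest : Type u
  treeAction : MulAction (Equiv.Perm ℕ) Tree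
  forestAction : MulAction (Equiv.Perm ℕ) Forest
  under : Tree → RTree
  underF : Forest → RForest
  delRoot : Tree → Forest
  restrict : Forest → Finset ℕ → Forest
  attach : Tree → Forest → (ℕ → ℕ) → Tree

attribute [instance] FamilyData.treeAction FamilyData.forestAction

/-- A family of trees. The first group of fields says that all operations are compatible with
renaming, that the structure lives on the nodes of the underlying tree or forest, and that
`attach` depends only on the values of the link map on the roots. The rest are the laws
for a family of trees. In `attach_attach`, the two link maps on the right are obtained from `d` and
`e`: the children of the root of `t₂` are linked by `e`, and a tree `s` of `delRoot t₁` is linked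
to `e s` if `d s` is the root of `t₂`, and to `d s` otherwise. In `attach_restrict`, `e` is
the one-node tree on the root of `t`. -/
structure Family extends FamilyData.{u} where
  under_smul : ∀ (σ : Equiv.Perm ℕ) (t : Tree), under (σ • t) = σ • under t
  underF_smul : ∀ (σ : Equiv.Perm ℕ) (V : Forest), underF (σ • V) = σ • underF V
  smul_eq_of_fix : ∀ (σ : Equiv.Perm ℕ) (t : Tree),
    (∀ v ∈ (under t).nodes, σ v = v) → σ • t = t
  smulF_eq_of_fix : ∀ (σ : Equiv.Perm ℕ) (V : Forest),
    (∀ v ∈ (underF V).nodes, σ v = v) → σ • V = V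
  delRoot_smul : ∀ (σ : Equiv.Perm ℕ) (t : Tree), delRoot (σ • t) = σ • delRoot t
  restrict_smul : ∀ (σ : Equiv.Perm ℕ) (V : Forest) (U : Finset ℕ), (underF V).IsSubforest U →
    restrict (σ • V) (U.map σ.toEmbedding) = σ • restrict V U
  attach_smul : ∀ (σ : Equiv.Perm ℕ) (t : Tree) (U : Forest) (d : ℕ → ℕ),
    (under t).IsLink (underF U) d →
      attach (σ • t) (σ • U) (fun v => σ (d (σ.symm v))) = σ • attach t U d
  attach_congr : ∀ (t : Tree) (U : Forest) (d d' : ℕ → ℕ), (under t).IsLink (underF U) d →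
    (∀ v ∈ (underF U).roots, d v = d' v) → attach t U d = attach t U d'
  underF_delRoot : ∀ t : Tree, underF (delRoot t) = (under t).delRoot
  exists_tree : ∀ T : RTree, ∃ t : Tree, under t = T
  exists_forest : ∀ F : RForest, ∃ V : Forest, underF V = F
  restrict_self : ∀ V : Forest, restrict V (underF V).nodes = V
  underF_restrict : ∀ (V : Forest) (U : Finset ℕ) (hU : (underF V).IsSubforest U),
    underF (restrict V U) = (underF V).restrict U hU
  restrict_restrict : ∀ (W : Forest) (U V : Finset ℕ), (underF W).IsSubforest U →
    (underF W).IsSubforest V → U ⊆ V → restrict W U = restrict (restrict W V) U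
  under_attach : ∀ (t : Tree) (U : Forest) (d : ℕ → ℕ) (h : (under t).IsLink (underF U) d),
    under (attach t U d) = (under t).attach (underF U) d h
  existsUnique_single : ∀ r : ℕ, ∃! e : Tree, under e = RTree.single r
  existsUnique_empty : ∃! V : Forest, underF V = RForest.empty
  attach_single_delRoot : ∀ t e : Tree, under e = RTree.single (under t).root →
    attach e (delRoot t) (fun _ => (under t).root) = t
  attach_empty : ∀ (t : Tree) (V : Forest) (d : ℕ → ℕ), underF V = RForest.empty →
    attach t V d = t
  delRoot_attach_single : ∀ (U : Forest) (e : Tree) (r : ℕ), under e = RTree.single r →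
    r ∉ (underF U).nodes → delRoot (attach e U fun _ => r) = U
  attach_attach : ∀ (t₁ t₂ t₃ : Tree) (d e : ℕ → ℕ),
    Disjoint (under t₁).nodes (under t₂).nodes → Disjoint (under t₁).nodes (under t₃).nodes →
    Disjoint (under t₂).nodes (under t₃).nodes →
    (under t₂).IsLink (underF (delRoot t₁)) d →
    (under t₃).IsLink (underF (delRoot (attach t₂ (delRoot t₁) d))) e →
      attach t₃ (delRoot (attach t₂ (delRoot t₁) d)) e =
        attach (attach t₃ (delRoot t₂) e) (delRoot t₁)
          (fun s => if d s = (under t₂).root then e s else d s)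
  attach_restrict : ∀ (t : Tree) (X : Forest) (d : ℕ → ℕ) (U : Finset ℕ) (e : Tree),
    (under t).IsLink (underF X) d →
    (underF (delRoot (attach t X d))).IsSubforest U →
    under e = RTree.single (under t).root →
      attach e (restrict (delRoot (attach t X d)) U) (fun _ => (under t).root) =
        attach
          (attach e (restrict (delRoot t) (U ∩ (under t).nodes)) fun _ => (under t).root)
          (restrict X (U ∩ (underF X).nodes)) d

/-- The set of all maps from the trees of the forest `U` to the nodes of `t` (extended by `0`). -/
noncomputable def links (t : RTree) (U : RForest) : Finset (ℕ → ℕ) :=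
  (U.roots.pi fun _ => t.nodes).image fun d v => if h : v ∈ U.roots then d v h else 0

theorem mem_links {t : RTree} {U : RForest} {d : ℕ → ℕ} :
    d ∈ links t U ↔ (∀ v ∈ U.roots, d v ∈ t.nodes) ∧ ∀ v ∉ U.roots, d v = 0 := by
  simp only [links, Finset.mem_image, Finset.mem_pi]
  constructor
  · rintro ⟨a, ha, rfl⟩
    constructor
    · intro v hv
      simpa [hv] using ha v hv
    · intro v hv
      simp [hv]
  · rintro ⟨h1, h2⟩
    refine ⟨fun v _ => d v, fun v hv => h1 v hv, ?_⟩
    funext v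
    by_cases hv : v ∈ U.roots
    · simp [hv]
    · simp [hv, h2 v hv]

namespace Family

variable (X : Family.{u})

/-- The trees of the family `X`, up to isomorphism (renaming of the nodes). -/
abbrev Cls : Type u := MulAction.orbitRel.Quotient (Equiv.Perm ℕ) X.Tree

variable {X}

/-- The isomorphism class of a tree. -/
def cls (t : X.Tree) : X.Cls := Quotient.mk'' t

theorem cls_eq_cls {s t : X.Tree} : cls s = cls t ↔ ∃ σ : Equiv.Perm ℕ, σ • t = s := by
  unfold cls
  rw [Quotient.eq'']
  exact Iff.rfl

theorem cls_smul (σ : Equiv.Perm ℕ) (t : X.Tree) : cls (σ • t) = cls t :=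
  cls_eq_cls.2 ⟨σ, rfl⟩

theorem smul_congr {σ τ : Equiv.Perm ℕ} {t : X.Tree}
    (h : ∀ v ∈ (X.under t).nodes, σ v = τ v) : σ • t = τ • t := by
  have := X.smul_eq_of_fix (τ⁻¹ * σ) t (by
    intro v hv
    simp [h v hv])
  rw [mul_smul] at this
  exact (eq_inv_smul_iff.1 this.symm).symm

theorem exists_rep_disjoint (c : X.Cls) (A : Finset ℕ) :
    ∃ t : X.Tree, cls t = c ∧ Disjoint (X.under t).nodes A := by
  induction c using Quotient.inductionOn' with
  | _ t =>
    obtain ⟨σ, hσ⟩ := Equiv.Perm.exists_extending_pair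
      (fun v : (X.under t).nodes => (v : ℕ)) (fun v => v + (A.sup id + 1))
      Subtype.val_injective (fun a b h => by ext; simpa using h)
    refine ⟨σ • t, cls_smul σ t, ?_⟩
    rw [X.under_smul, RTree.toRForest_smul, RForest.nodes_smul, Finset.disjoint_left]
    intro a ha hA
    obtain ⟨v, hv, rfl⟩ := Finset.mem_map.1 ha
    have h1 := hσ ⟨v, hv⟩
    have h2 := Finset.le_sup (f := id) hA
    simp at h1 h2
    omega

theorem exists_disjoint_reps (c₁ c₂ : X.Cls) : ∃ p : X.Tree × X.Tree, cls p.1 = c₁ ∧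
    cls p.2 = c₂ ∧ Disjoint (X.under p.1).nodes (X.under p.2).nodes := by
  obtain ⟨t₂, h₂, -⟩ := X.exists_rep_disjoint c₂ ∅
  obtain ⟨t₁, h₁, h⟩ := X.exists_rep_disjoint c₁ (X.under t₂).nodes
  exact ⟨(t₁, t₂), h₁, h₂, h⟩

theorem nodes_smul (σ : Equiv.Perm ℕ) (t : X.Tree) :
    (X.under (σ • t)).nodes = (X.under t).nodes.map σ.toEmbedding := by
  rw [X.under_smul, RTree.toRForest_smul, RForest.nodes_smul]

theorem exists_smul_eq_of_disjoint {t₁ t₂ s₁ s₂ : X.Tree} (h₁ : cls s₁ = cls t₁)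
    (h₂ : cls s₂ = cls t₂) (hs : Disjoint (X.under s₁).nodes (X.under s₂).nodes)
    (ht : Disjoint (X.under t₁).nodes (X.under t₂).nodes) :
    ∃ σ : Equiv.Perm ℕ, σ • t₁ = s₁ ∧ σ • t₂ = s₂ := by
  obtain ⟨σ₁, rfl⟩ := cls_eq_cls.1 h₁
  obtain ⟨σ₂, rfl⟩ := cls_eq_cls.1 h₂
  rw [nodes_smul, nodes_smul, Finset.disjoint_left] at hs
  rw [Finset.disjoint_left] at ht
  obtain ⟨σ, hσ⟩ := Equiv.Perm.exists_extending_pair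
    (fun v : ↥((X.under t₁).nodes ∪ (X.under t₂).nodes) => (v : ℕ))
    (fun v => if (v : ℕ) ∈ (X.under t₁).nodes then σ₁ v else σ₂ v)
    Subtype.val_injective (by
      rintro ⟨a, ha⟩ ⟨b, hb⟩ h
      ext
      rw [Finset.mem_union] at ha hb
      simp only [Finset.mem_map, Equiv.coe_toEmbedding] at hs
      simp only at h ⊢
      split_ifs at h with h1 h2 h2
      · exact σ₁.injective h
      · exact absurd ⟨b, hb.resolve_left h2, h.symm⟩ (hs ⟨a, h1, rfl⟩)
      · exact absurd ⟨a, ha.resolve_left h1, h⟩ (hs ⟨b, h2, rfl⟩)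
      · exact σ₂.injective h)
  refine ⟨σ, smul_congr fun v hv => ?_, smul_congr fun v hv => ?_⟩
  · have := hσ ⟨v, Finset.mem_union_left _ hv⟩
    simpa [hv] using this
  · have := hσ ⟨v, Finset.mem_union_right _ hv⟩
    have h3 : v ∉ (X.under t₁).nodes := fun h => ht h hv
    simpa [h3] using this

theorem roots_smul (σ : Equiv.Perm ℕ) (F : RForest) :
    (σ • F).roots = F.roots.map σ.toEmbedding := by
  ext v
  simp only [RForest.mem_roots, Finset.mem_map_equiv, RForest.nodes_smul, RForest.parent_smul,
    Option.map_eq_none_iff]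

theorem underF_delRoot_nodes (t : X.Tree) :
    (X.underF (X.delRoot t)).nodes = (X.under t).nodes.erase (X.under t).root := by
  rw [X.underF_delRoot]; rfl

theorem disjoint_delRoot {t : X.Tree} {A : Finset ℕ} (h : Disjoint A (X.under t).nodes) :
    Disjoint A (X.underF (X.delRoot t)).nodes := by
  rw [underF_delRoot_nodes]
  exact h.mono_right (Finset.erase_subset _ _)

variable (k : Type v) [Field k]

/-- The vector space over `k` with basis the trees of the family `X`, up to isomorphism. -/
def TreeAlgebra (k : Type v) [Field k] (X : Family.{u}) : Type (max u v) := X.Cls →₀ k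

noncomputable instance : AddCommGroup (TreeAlgebra k X) :=
  inferInstanceAs (AddCommGroup (X.Cls →₀ k))

noncomputable instance : Module k (TreeAlgebra k X) :=
  inferInstanceAs (Module k (X.Cls →₀ k))

variable (X) in
/-- The basis of the tree algebra which consists of the trees. -/
noncomputable def treeBasis : Module.Basis X.Cls k (TreeAlgebra k X) :=
  Finsupp.basisSingleOne (R := k) (ι := X.Cls)

/-- The sum of the trees `t ⇀_d U`, over all maps `d` from the trees of `U` to the nodes of `t`. -/
noncomputable def linkSum (t : X.Tree) (U : X.Forest) : TreeAlgebra k X :=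
  ∑ d ∈ links (X.under t) (X.underF U), treeBasis X k (cls (X.attach t U d))

theorem linkSum_smul (σ : Equiv.Perm ℕ) (t : X.Tree) (U : X.Forest)
    (h : Disjoint (X.under t).nodes (X.underF U).nodes) :
    linkSum k (σ • t) (σ • U) = linkSum k t U := by
  symm
  unfold linkSum
  have hr : (X.underF (σ • U)).roots = (X.underF U).roots.map σ.toEmbedding := by
    rw [X.underF_smul, roots_smul]
  have hn := nodes_smul σ t
  refine Finset.sum_bij'
    (fun d _ v => if v ∈ (X.underF (σ • U)).roots then σ (d (σ.symm v)) else 0)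
    (fun d _ v => if v ∈ (X.underF U).roots then σ.symm (d (σ v)) else 0) ?_ ?_ ?_ ?_ ?_
  · intro d hd
    rw [mem_links] at hd ⊢
    rw [hr, hn]
    constructor
    · intro v hv
      have := hd.1 (σ.symm v) (by simpa [Finset.mem_map_equiv] using hv)
      simp only [hv, if_true, Finset.mem_map_equiv, Equiv.symm_apply_apply]
      exact this
    · intro v hv
      exact if_neg hv
  · intro d hd
    rw [mem_links] at hd ⊢
    rw [hr, hn] at hd
    constructor
    · intro v hv
      have := hd.1 (σ v) (by simpa [Finset.mem_map_equiv] using hv)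
      simp only [hv, if_true]
      simpa only [Finset.mem_map_equiv] using this
    · intro v hv
      simp [hv]
  · intro d hd
    rw [mem_links] at hd
    funext v
    by_cases hv : v ∈ (X.underF U).roots
    · have : σ v ∈ (X.underF (σ • U)).roots := by
        rw [hr, Finset.mem_map_equiv]; simpa using hv
      simp [hv, this]
    · simp [hv, hd.2 v hv]
  · intro d hd
    rw [mem_links] at hd
    funext v
    by_cases hv : v ∈ (X.underF (σ • U)).roots
    · have : σ.symm v ∈ (X.underF U).roots := by
        rwa [hr, Finset.mem_map_equiv] at hv
      simp [hv, this]
    · simp [hv, hd.2 v hv]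
  · intro d hd
    rw [mem_links] at hd
    have hl : (X.under t).IsLink (X.underF U) d := ⟨h, hd.1⟩
    rw [← cls_smul σ (X.attach t U d), ← X.attach_smul σ t U d hl]
    congr 2
    have hd1 := hd.1
    refine X.attach_congr _ _ _ _ ⟨?_, ?_⟩ ?_
    · rw [hn, X.underF_smul, RForest.nodes_smul, Finset.disjoint_map]
      exact h
    · intro v hv
      rw [hr, Finset.mem_map_equiv] at hv
      rw [hn, Finset.mem_map_equiv]
      simpa using hd1 _ hv
    · intro v hv
      simp [hv]

/-- The product of two trees: the sum of the trees `t₂ ⇀_d delRoot t₁`, over all maps `d` from the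
trees of `delRoot t₁` to the nodes of `t₂`, for representatives `t₁`, `t₂` without common node
names; by `prodCls_eq` the choice of representatives does not matter. -/
noncomputable def prodCls (c₁ c₂ : X.Cls) : TreeAlgebra k X :=
  linkSum k (X.exists_disjoint_reps c₁ c₂).choose.2
    (X.delRoot (X.exists_disjoint_reps c₁ c₂).choose.1)

theorem prodCls_eq {t₁ t₂ : X.Tree} (h : Disjoint (X.under t₁).nodes (X.under t₂).nodes) :
    prodCls k (cls t₁) (cls t₂) = linkSum k t₂ (X.delRoot t₁) := by
  have hc := (X.exists_disjoint_reps (cls t₁) (cls t₂)).choose_spec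
  unfold prodCls
  generalize (X.exists_disjoint_reps (cls t₁) (cls t₂)).choose = p at hc ⊢
  obtain ⟨σ, h1, h2⟩ := exists_smul_eq_of_disjoint hc.1 hc.2.1 hc.2.2 h
  rw [← h1, ← h2, X.delRoot_smul]
  exact linkSum_smul k σ _ _ (disjoint_delRoot h.symm)

/-- The operation `t₁ ⊙ t₂`, which attaches all trees of `delRoot t₁` to the root of `t₂`, for
representatives `t₁`, `t₂` without common node names; by `odot_eq` the choice of representatives
does not matter. -/
noncomputable def odot (c₁ c₂ : X.Cls) : X.Cls :=
  cls (X.attach (X.exists_disjoint_reps c₁ c₂).choose.2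
    (X.delRoot (X.exists_disjoint_reps c₁ c₂).choose.1)
    fun _ => (X.under (X.exists_disjoint_reps c₁ c₂).choose.2).root)

theorem odot_eq {t₁ t₂ : X.Tree} (h : Disjoint (X.under t₁).nodes (X.under t₂).nodes) :
    odot (cls t₁) (cls t₂) = cls (X.attach t₂ (X.delRoot t₁) fun _ => (X.under t₂).root) := by
  have hc := (X.exists_disjoint_reps (cls t₁) (cls t₂)).choose_spec
  unfold odot
  generalize (X.exists_disjoint_reps (cls t₁) (cls t₂)).choose = p at hc ⊢
  obtain ⟨σ, h1, h2⟩ := exists_smul_eq_of_disjoint hc.1 hc.2.1 hc.2.2 h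
  have hl : (X.under t₂).IsLink (X.underF (X.delRoot t₁)) fun _ => (X.under t₂).root :=
    ⟨disjoint_delRoot h.symm, fun _ _ => (X.under t₂).root_mem⟩
  rw [← h1, ← h2, X.delRoot_smul, X.under_smul, RTree.root_smul, X.attach_smul σ _ _ _ hl,
    cls_smul]

variable (X) in
/-- The tree `e` with one node. -/
noncomputable def unit : X.Cls := cls (X.existsUnique_single 0).choose

theorem cls_eq_unit {e : X.Tree} {r : ℕ} (he : X.under e = RTree.single r) :
    cls e = X.unit := by
  have h0 := (X.existsUnique_single 0).choose_spec.1
  unfold unit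
  generalize (X.existsUnique_single 0).choose = e0 at h0 ⊢
  symm
  refine cls_eq_cls.2 ⟨Equiv.swap r 0, ?_⟩
  refine (X.existsUnique_single 0).unique ?_ h0
  rw [X.under_smul, he]
  refine RTree.ext' ?_
  ext1
  · ext v
    simp [RTree.toRForest_smul, RForest.nodes_smul, RTree.single]
  · funext v
    simp [RTree.toRForest_smul, RForest.parent_smul, RTree.single]

theorem exists_single_rep (A : Finset ℕ) : ∃ (e : X.Tree) (r : ℕ), r ∉ A ∧
    X.under e = RTree.single r ∧ cls e = X.unit := by
  obtain ⟨r, hr⟩ := Infinite.exists_notMem_finset A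
  obtain ⟨e, he, -⟩ := X.existsUnique_single r
  exact ⟨e, r, hr, he, cls_eq_unit he⟩

theorem under_delRoot_single {e : X.Tree} {r : ℕ} (he : X.under e = RTree.single r) :
    X.underF (X.delRoot e) = RForest.empty := by
  rw [X.underF_delRoot, he]
  ext1
  · simp [RTree.single, RTree.delRoot, RForest.empty]
  · funext v
    simp [RTree.single, RTree.delRoot, RForest.empty]

theorem unit_prodCls (c : X.Cls) : prodCls k X.unit c = treeBasis X k c := by
  obtain ⟨t, rfl, -⟩ := X.exists_rep_disjoint c ∅
  obtain ⟨e, r, hr, he, hu⟩ := X.exists_single_rep (X.under t).nodes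
  rw [← hu, prodCls_eq k (by rw [he]; simpa [RTree.single] using hr)]
  have h0 := under_delRoot_single he
  unfold linkSum
  rw [h0]
  have : links (X.under t) RForest.empty = {fun _ => 0} := by
    ext d
    simp [mem_links, RForest.mem_roots, RForest.empty, funext_iff]
  rw [this, Finset.sum_singleton, X.attach_empty _ _ _ h0]

theorem prodCls_unit (c : X.Cls) : prodCls k c X.unit = treeBasis X k c := by
  obtain ⟨t, rfl, -⟩ := X.exists_rep_disjoint c ∅
  obtain ⟨e, r, hr, he, hu⟩ := X.exists_single_rep (X.under t).nodes
  rw [← hu, prodCls_eq k (by rw [he]; simpa [RTree.single] using hr)]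
  obtain ⟨e', he', -⟩ := X.existsUnique_single (X.under t).root
  obtain ⟨σ, hσ⟩ := cls_eq_cls.1 ((cls_eq_unit he').trans (cls_eq_unit he).symm)
  have hD : Disjoint (X.under e).nodes (X.underF (X.delRoot t)).nodes :=
    disjoint_delRoot (by rw [he]; simpa [RTree.single] using hr)
  have : links (X.under e) (X.underF (X.delRoot t)) =
      {fun v => if v ∈ (X.underF (X.delRoot t)).roots then r else 0} := by
    ext d
    rw [mem_links, he]
    simp only [RTree.single, Finset.mem_singleton, funext_iff]
    grind
  unfold linkSum
  rw [this, Finset.sum_singleton]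
  congr 1
  set τ := Equiv.swap r (X.under t).root with hτ
  have hfix : τ • X.delRoot t = X.delRoot t := by
    refine X.smulF_eq_of_fix _ _ fun v hv => ?_
    rw [underF_delRoot_nodes] at hv
    refine Equiv.swap_apply_of_ne_of_ne ?_ (Finset.ne_of_mem_erase hv)
    rintro rfl
    exact hr (Finset.mem_of_mem_erase hv)
  have hl : (X.under e).IsLink (X.underF (X.delRoot t)) (fun _ => r) :=
    ⟨hD, by simp [he, RTree.single]⟩
  rw [← X.attach_congr e _ _ _ hl (by intro v hv; simp [hv])]
  rw [← cls_smul τ, ← X.attach_smul τ _ _ _ hl, hfix]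
  have hte : τ • e = e' := by
    refine (X.existsUnique_single (X.under t).root).unique ?_ he'
    rw [X.under_smul, he]
    refine RTree.ext' ?_
    ext1
    · ext v
      simp [RTree.toRForest_smul, RForest.nodes_smul, RTree.single, hτ]
    · funext v
      simp [RTree.toRForest_smul, RForest.parent_smul, RTree.single]
  have h1 : (fun _ : ℕ => τ r) = fun _ => (X.under t).root := by simp [hτ]
  rw [hte, h1, X.attach_single_delRoot t e' he']

end Family

namespace Family
variable {X : Family.{u}} (k : Type v) [Field k]

theorem nodes_attach {t : X.Tree} {U : X.Forest} {d : ℕ → ℕ}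
    (h : (X.under t).IsLink (X.underF U) d) :
    (X.under (X.attach t U d)).nodes = (X.under t).nodes ∪ (X.underF U).nodes := by
  rw [X.under_attach _ _ _ h]; rfl

theorem mem_roots_delRoot {t : X.Tree} {v : ℕ} :
    v ∈ (X.underF (X.delRoot t)).roots ↔ (X.under t).parent v = some (X.under t).root := by
  rw [X.underF_delRoot, RForest.mem_roots]
  have h1 := (X.under t).parent_root
  have h2 := @RTree.parent_eq_none (X.under t) v
  have h3 := @(X.under t).mem_of_parent v (X.under t).root
  simp only [RTree.delRoot, Finset.mem_erase]
  grind

theorem mem_roots_delRoot_attach {t : X.Tree} {U : X.Forest} {d : ℕ → ℕ}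
    (h : (X.under t).IsLink (X.underF U) d) {v : ℕ} :
    v ∈ (X.underF (X.delRoot (X.attach t U d))).roots ↔
      v ∈ (X.underF (X.delRoot t)).roots ∨ v ∈ (X.underF U).roots ∧ d v = (X.under t).root := by
  rw [mem_roots_delRoot, mem_roots_delRoot, X.under_attach _ _ _ h]
  have h3 := @(X.under t).mem_of_parent v (X.under t).root
  have h4 := @(X.underF U).mem_of_parent v (X.under t).root
  have h5 := @RForest.mem_roots (X.underF U) v
  have h6 := (X.under t).root_mem
  have h7 := Finset.disjoint_left.1 h.1
  simp only [RTree.attach]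
  grind

theorem sum_assoc (t₁ t₂ t₃ : X.Tree)
    (h12 : Disjoint (X.under t₁).nodes (X.under t₂).nodes)
    (h13 : Disjoint (X.under t₁).nodes (X.under t₃).nodes)
    (h23 : Disjoint (X.under t₂).nodes (X.under t₃).nodes) :
    (∑ d ∈ links (X.under t₂) (X.underF (X.delRoot t₁)),
      linkSum k t₃ (X.delRoot (X.attach t₂ (X.delRoot t₁) d))) =
    ∑ f ∈ links (X.under t₃) (X.underF (X.delRoot t₂)),
      linkSum k (X.attach t₃ (X.delRoot t₂) f) (X.delRoot t₁) := by
  unfold linkSum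
  rw [Finset.sum_sigma', Finset.sum_sigma']
  have dis1 := Finset.disjoint_left.1 h12
  have dis2 := Finset.disjoint_left.1 h13
  have dis3 := Finset.disjoint_left.1 h23
  have hn1 := underF_delRoot_nodes t₁
  have hn2 := underF_delRoot_nodes t₂
  have rt1 := (X.under t₁).root_mem
  have rt2 := (X.under t₂).root_mem
  have rm1 : ∀ v, v ∈ (X.underF (X.delRoot t₁)).roots → v ∈ (X.under t₁).nodes := by
    intro v hv
    have := (RForest.mem_roots.1 hv).1
    grind
  have rm2 : ∀ v, v ∈ (X.underF (X.delRoot t₂)).roots → v ∈ (X.under t₂).nodes := by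
    intro v hv
    have := (RForest.mem_roots.1 hv).1
    grind
  have L1 : ∀ d, (∀ v ∈ (X.underF (X.delRoot t₁)).roots, d v ∈ (X.under t₂).nodes) →
      (X.under t₂).IsLink (X.underF (X.delRoot t₁)) d :=
    fun d hd => ⟨disjoint_delRoot h12.symm, hd⟩
  have L2 : ∀ d, (∀ v ∈ (X.underF (X.delRoot t₂)).roots, d v ∈ (X.under t₃).nodes) →
      (X.under t₃).IsLink (X.underF (X.delRoot t₂)) d :=
    fun d hd => ⟨disjoint_delRoot h23.symm, hd⟩
  refine Finset.sum_bij'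
    (fun p _ => ⟨fun s => if s ∈ (X.underF (X.delRoot t₂)).roots then p.2 s else 0,
      fun s => if s ∈ (X.underF (X.delRoot t₁)).roots then
        (if p.1 s = (X.under t₂).root then p.2 s else p.1 s) else 0⟩)
    (fun q _ => ⟨fun s => if s ∈ (X.underF (X.delRoot t₁)).roots then
        (if q.2 s ∈ (X.under t₂).nodes then q.2 s else (X.under t₂).root) else 0,
      fun s => if s ∈ (X.underF (X.delRoot t₂)).roots then q.1 s else
        if s ∈ (X.underF (X.delRoot t₁)).roots ∧ q.2 s ∉ (X.under t₂).nodes then q.2 s else 0⟩)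
    ?_ ?_ ?_ ?_ ?_
  · rintro ⟨d, e⟩ hp
    simp only [Finset.mem_sigma, mem_links] at hp ⊢
    obtain ⟨⟨hd, hd0⟩, he, he0⟩ := hp
    simp only [mem_roots_delRoot_attach (L1 d hd)] at he he0
    have hf : ∀ v ∈ (X.underF (X.delRoot t₂)).roots, (fun s =>
        if s ∈ (X.underF (X.delRoot t₂)).roots then e s else 0) v ∈ (X.under t₃).nodes := by
      grind
    rw [nodes_attach (L2 _ hf)]
    refine ⟨⟨hf, by grind⟩, ?_, ?_⟩
    · intro v hv
      grind
    · intro v hv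
      grind
  · rintro ⟨f, g⟩ hq
    simp only [Finset.mem_sigma, mem_links] at hq ⊢
    obtain ⟨⟨hf, hf0⟩, hg, hg0⟩ := hq
    rw [nodes_attach (L2 _ hf)] at hg
    have hd : ∀ v ∈ (X.underF (X.delRoot t₁)).roots, (fun s =>
        if s ∈ (X.underF (X.delRoot t₁)).roots then
        (if g s ∈ (X.under t₂).nodes then g s else (X.under t₂).root) else 0) v ∈
          (X.under t₂).nodes := by
      grind
    simp only [mem_roots_delRoot_attach (L1 _ hd)]
    grind
  · rintro ⟨d, e⟩ hp
    simp only [Finset.mem_sigma, mem_links] at hp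
    obtain ⟨⟨hd, hd0⟩, he, he0⟩ := hp
    simp only [mem_roots_delRoot_attach (L1 d hd)] at he he0
    congr 1
    · funext s
      grind
    · funext s
      grind
  · rintro ⟨f, g⟩ hq
    simp only [Finset.mem_sigma, mem_links] at hq
    obtain ⟨⟨hf, hf0⟩, hg, hg0⟩ := hq
    rw [nodes_attach (L2 _ hf)] at hg
    congr 1
    · funext s
      grind
    · funext s
      grind
  · rintro ⟨d, e⟩ hp
    simp only [Finset.mem_sigma, mem_links] at hp
    obtain ⟨⟨hd, hd0⟩, he, he0⟩ := hp
    have hl : (X.under t₃).IsLink (X.underF (X.delRoot (X.attach t₂ (X.delRoot t₁) d))) e := by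
      refine ⟨disjoint_delRoot ?_, he⟩
      rw [nodes_attach (L1 d hd), hn1, Finset.disjoint_right]
      grind
    simp only [mem_roots_delRoot_attach (L1 d hd)] at he he0
    rw [X.attach_attach t₁ t₂ t₃ d e h12 h13 h23 (L1 d hd) hl]
    have hf : ∀ v ∈ (X.underF (X.delRoot t₂)).roots, (fun s =>
        if s ∈ (X.underF (X.delRoot t₂)).roots then e s else 0) v ∈ (X.under t₃).nodes := by
      grind
    rw [X.attach_congr t₃ _ e _ (L2 _ fun v hv => he v (Or.inl hv))
      (fun v hv => (if_pos hv).symm)]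
    refine congrArg (fun z => treeBasis X k (cls z)) (X.attach_congr _ _ _ _ ⟨?_, ?_⟩ ?_)
    · rw [nodes_attach (L2 _ hf), hn1, Finset.disjoint_left]
      grind
    · rw [nodes_attach (L2 _ hf)]
      grind
    · grind

variable (X) in
/-- The bilinear extension of the product of trees. -/
noncomputable def mulHom : TreeAlgebra k X →ₗ[k] TreeAlgebra k X →ₗ[k] TreeAlgebra k X :=
  (treeBasis X k).constr k fun c₁ => (treeBasis X k).constr k fun c₂ => prodCls k c₁ c₂

theorem mulHom_basis (c₁ c₂ : X.Cls) :
    mulHom X k (treeBasis X k c₁) (treeBasis X k c₂) = prodCls k c₁ c₂ := by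
  rw [mulHom, Module.Basis.constr_basis, Module.Basis.constr_basis]

theorem mulHom_assoc (a b c : TreeAlgebra k X) :
    mulHom X k (mulHom X k a b) c = mulHom X k a (mulHom X k b c) := by
  have hof : ∀ c₁ c₂ c₃ : X.Cls, mulHom X k (mulHom X k (treeBasis X k c₁) (treeBasis X k c₂)) (treeBasis X k c₃) =
      mulHom X k (treeBasis X k c₁) (mulHom X k (treeBasis X k c₂) (treeBasis X k c₃)) := by
    intro c₁ c₂ c₃
    obtain ⟨t₃, rfl, -⟩ := X.exists_rep_disjoint c₃ ∅
    obtain ⟨t₂, rfl, h23⟩ := X.exists_rep_disjoint c₂ (X.under t₃).nodes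
    obtain ⟨t₁, rfl, h1⟩ := X.exists_rep_disjoint c₁ ((X.under t₂).nodes ∪ (X.under t₃).nodes)
    rw [Finset.disjoint_union_right] at h1
    rw [mulHom_basis, mulHom_basis, prodCls_eq k h1.1, prodCls_eq k h23, linkSum, linkSum,
      map_sum, map_sum, LinearMap.sum_apply]
    refine Eq.trans (Finset.sum_congr rfl fun d hd => ?_) ((sum_assoc k t₁ t₂ t₃ h1.1 h1.2 h23).trans
      (Finset.sum_congr rfl fun f hf => ?_))
    · rw [mulHom_basis, prodCls_eq]
      have hl : (X.under t₂).IsLink (X.underF (X.delRoot t₁)) d :=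
        ⟨disjoint_delRoot h1.1.symm, (mem_links.1 hd).1⟩
      rw [nodes_attach hl, Finset.disjoint_union_left]
      exact ⟨h23, (disjoint_delRoot h1.2.symm).symm⟩
    · have hl : (X.under t₃).IsLink (X.underF (X.delRoot t₂)) f :=
        ⟨disjoint_delRoot h23.symm, (mem_links.1 hf).1⟩
      rw [mulHom_basis, prodCls_eq]
      rw [nodes_attach hl, Finset.disjoint_union_right]
      exact ⟨h1.2, disjoint_delRoot h1.1⟩
  have h1 : ∀ (c₃ c₂ : X.Cls) (a : TreeAlgebra k X),
      mulHom X k (mulHom X k a (treeBasis X k c₂)) (treeBasis X k c₃) =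
      mulHom X k a (mulHom X k (treeBasis X k c₂) (treeBasis X k c₃)) := fun c₃ c₂ a =>
    LinearMap.congr_fun (f := ((mulHom X k).flip (treeBasis X k c₃)) ∘ₗ
      (mulHom X k).flip (treeBasis X k c₂))
      (g := (mulHom X k).flip (mulHom X k (treeBasis X k c₂) (treeBasis X k c₃)))
      ((treeBasis X k).ext fun c₁ => hof c₁ c₂ c₃) a
  have h2 : ∀ (c₃ : X.Cls) (b a : TreeAlgebra k X),
      mulHom X k (mulHom X k a b) (treeBasis X k c₃) =
      mulHom X k a (mulHom X k b (treeBasis X k c₃)) := fun c₃ b a =>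
    LinearMap.congr_fun (f := ((mulHom X k).flip (treeBasis X k c₃)) ∘ₗ mulHom X k a)
      (g := mulHom X k a ∘ₗ (mulHom X k).flip (treeBasis X k c₃))
      ((treeBasis X k).ext fun c₂ => h1 c₃ c₂ a) b
  exact LinearMap.congr_fun (f := mulHom X k (mulHom X k a b))
      (g := mulHom X k a ∘ₗ mulHom X k b)
      ((treeBasis X k).ext fun c₃ => h2 c₃ b a) c

theorem mulHom_unit (a : TreeAlgebra k X) : mulHom X k a (treeBasis X k X.unit) = a :=
  LinearMap.congr_fun (f := (mulHom X k).flip (treeBasis X k X.unit)) (g := LinearMap.id)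
    ((treeBasis X k).ext fun c => by
      rw [LinearMap.flip_apply, mulHom_basis, prodCls_unit, LinearMap.id_apply]) a

theorem unit_mulHom (a : TreeAlgebra k X) : mulHom X k (treeBasis X k X.unit) a = a :=
  LinearMap.congr_fun (g := LinearMap.id)
    ((treeBasis X k).ext fun c => by
      rw [mulHom_basis, unit_prodCls, LinearMap.id_apply]) a

/-- The algebra `k{X}`: the product is the bilinear extension of the product of trees, and the unit
is the tree with one node. -/
noncomputable instance : Ring (TreeAlgebra k X) :=
  { (inferInstance : AddCommGroup (TreeAlgebra k X)) with
    mul := fun a b => mulHom X k a b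
    one := treeBasis X k X.unit
    mul_assoc := mulHom_assoc k
    one_mul := unit_mulHom k
    mul_one := mulHom_unit k
    zero_mul := fun a => LinearMap.map_zero₂ (mulHom X k) a
    mul_zero := fun a => map_zero (mulHom X k a)
    left_distrib := fun a b c => map_add (mulHom X k a) b c
    right_distrib := fun a b c => LinearMap.map_add₂ (mulHom X k) a b c }

noncomputable instance : Algebra k (TreeAlgebra k X) :=
  Algebra.ofModule (fun r a b => LinearMap.map_smul₂ (mulHom X k) r a b)
    (fun r a b => map_smul (mulHom X k a) r b)

/-- A tree `t ≠ e` is indecomposable if `t = t₁ ⊙ t₂` implies `t₁ = e` or `t₂ = e`. -/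
def IsIndecomposable (c : X.Cls) : Prop :=
  c ≠ X.unit ∧ ∀ c₁ c₂ : X.Cls, c = odot c₁ c₂ → c₁ = X.unit ∨ c₂ = X.unit

variable (X) in
/-- The set of indecomposable trees of the family, up to isomorphism. -/
abbrev Indecomposables : Type u := {c : X.Cls // IsIndecomposable c}

variable (X) in
/-- The unique decomposition property: `x₁ ⊙ ⋯ ⊙ x_p = y₁ ⊙ ⋯ ⊙ y_q` with all `x_i` and `y_j`
indecomposable implies that the two sequences are equal. -/
def UniqueDecomposition : Prop :=
  ∀ xs ys : List X.Indecomposables,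
    (xs.map Subtype.val).foldr odot X.unit = (ys.map Subtype.val).foldr odot X.unit → xs = ys

end Family

namespace RForest

/-- `a` is a proper ancestor of `b`. -/
def IsAncestor (F : RForest) (a b : ℕ) : Prop :=
  Relation.TransGen (fun p v => F.parent v = some p) a b

theorem IsAncestor.mono {F G : RForest} (h : ∀ v p, F.parent v = some p → G.parent v = some p)
    {a b : ℕ} (hab : F.IsAncestor a b) : G.IsAncestor a b :=
  Relation.TransGen.mono (fun p v => h v p) _ _ hab

theorem isAncestor_smul {σ : Equiv.Perm ℕ} {F : RForest} {a b : ℕ}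
    (h : (σ • F).IsAncestor a b) : F.IsAncestor (σ.symm a) (σ.symm b) := by
  refine Relation.TransGen.lift σ.symm ?_ _ _ h
  intro p v hpv
  obtain ⟨q, hq, rfl⟩ := Option.map_eq_some_iff.1 hpv
  simpa [Function.onFun] using hq

end RForest

theorem RTree.IsAncestor_attach {t : RTree} {U : RForest} {d : ℕ → ℕ} (h : t.IsLink U d)
    {a b : ℕ} (hab : (t.attach U d h).IsAncestor a b) :
    t.IsAncestor a b ∨ U.IsAncestor a b ∨ (a ∈ t.nodes ∧ b ∈ U.nodes) := by
  have key : ∀ p v, (t.attach U d h).parent v = some p →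
      t.parent v = some p ∨ U.parent v = some p ∨ (p ∈ t.nodes ∧ v ∈ U.nodes) := by
    intro p v hpv
    have h3 := h.2 v
    have h4 := @RForest.mem_roots U v
    simp only [RTree.attach] at hpv
    grind
  have dis := Finset.disjoint_left.1 h.1
  have memt : ∀ a b, t.IsAncestor a b → a ∈ t.nodes ∧ b ∈ t.nodes := by
    intro a b hab
    induction hab with
    | single h => exact (t.mem_of_parent h).symm
    | tail _ h ih => exact ⟨ih.1, (t.mem_of_parent h).1⟩
  have memU : ∀ a b, U.IsAncestor a b → a ∈ U.nodes ∧ b ∈ U.nodes := by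
    intro a b hab
    induction hab with
    | single h => exact (U.mem_of_parent h).symm
    | tail _ h ih => exact ⟨ih.1, (U.mem_of_parent h).1⟩
  induction hab with
  | single h =>
    rcases key _ _ h with h | h | h
    · exact Or.inl (.single h)
    · exact Or.inr (Or.inl (.single h))
    · exact Or.inr (Or.inr h)
  | @tail b c _ h ih =>
    rcases key _ _ h with h | h | h
    · have hb := t.mem_of_parent h
      rcases ih with ih | ih | ih
      · exact Or.inl (.tail ih h)
      · exact absurd (memU _ _ ih).2 (dis hb.2)
      · exact absurd ih.2 (dis hb.2)
    · have hb := U.mem_of_parent h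
      rcases ih with ih | ih | ih
      · exact absurd hb.2 (dis (memt _ _ ih).2)
      · exact Or.inr (Or.inl (.tail ih h))
      · exact Or.inr (Or.inr ⟨ih.1, hb.1⟩)
    · rcases ih with ih | ih | ih
      · exact Or.inr (Or.inr ⟨(memt _ _ ih).1, h.2⟩)
      · exact absurd (memU _ _ ih).2 (dis h.1)
      · exact Or.inr (Or.inr ⟨ih.1, h.2⟩)

/-- A rule which selects, for every forest (and for every tree, seen as a forest with one root), some
sets of nodes, the blocks, which are to be totally ordered; together with the closure properties
that let these orderings be transported along the operations of a family of trees. -/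
structure BlockSystem where
  blocks : RForest → Set (Set ℕ)
  subset_nodes : ∀ {F : RForest} {S : Set ℕ}, S ∈ blocks F → S ⊆ F.nodes
  smul : ∀ (σ : Equiv.Perm ℕ) {F : RForest} {S : Set ℕ}, S ∈ blocks F → σ '' S ∈ blocks (σ • F)
  delRoot : ∀ {t : RTree} {S : Set ℕ}, S ∈ blocks t.delRoot → ∃ S' ∈ blocks t.toRForest, S ⊆ S'
  restrict : ∀ {F : RForest} {U : Finset ℕ} (hU : F.IsSubforest U) {S : Set ℕ},
    S ∈ blocks (F.restrict U hU) → ∃ S' ∈ blocks F, S ⊆ S'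
  attach_left : ∀ {t : RTree} {U : RForest} {d : ℕ → ℕ} (h : t.IsLink U d) {S : Set ℕ},
    S ∈ blocks (t.attach U d h).toRForest → ∃ S' ∈ blocks t.toRForest, S ∩ t.nodes ⊆ S'
  attach_right : ∀ {t : RTree} {U : RForest} {d : ℕ → ℕ} (h : t.IsLink U d) {S : Set ℕ},
    S ∈ blocks (t.attach U d h).toRForest → ∃ S' ∈ blocks U, S ∩ U.nodes ⊆ S'

namespace BlockSystem

variable (B : BlockSystem)

/-- Two nodes are comparable if they lie in a common block. -/
def Comparable (F : RForest) (a b : ℕ) : Prop := ∃ S ∈ B.blocks F, a ∈ S ∧ b ∈ S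

/-- A total ordering on each block, consistent on the intersections of the blocks, such that every
node precedes its descendants in the blocks that contain it. As the orderings are consistent, they are given by
one relation `lt`, which holds only between nodes of a common block. -/
structure IsOrdering (F : RForest) (lt : ℕ → ℕ → Prop) : Prop where
  comparable : ∀ {a b}, lt a b → B.Comparable F a b
  irrefl : ∀ a, ¬ lt a a
  trans : ∀ {S}, S ∈ B.blocks F → ∀ {a b c}, a ∈ S → b ∈ S → c ∈ S → lt a b → lt b c → lt a c
  total : ∀ {S}, S ∈ B.blocks F → ∀ {a b}, a ∈ S → b ∈ S → a ≠ b → lt a b ∨ lt b a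
  ancestor : ∀ {a b}, B.Comparable F a b → F.IsAncestor a b → lt a b

/-- A forest with ordered blocks. -/
@[ext]
structure OForest where
  forest : RForest
  lt : ℕ → ℕ → Prop
  isOrdering : B.IsOrdering forest lt

/-- A tree with ordered blocks. -/
@[ext]
structure OTree where
  tree : RTree
  lt : ℕ → ℕ → Prop
  isOrdering : B.IsOrdering tree.toRForest lt

variable {B}

theorem comparable_smul {σ : Equiv.Perm ℕ} {F : RForest} {a b : ℕ} :
    B.Comparable (σ • F) a b ↔ B.Comparable F (σ.symm a) (σ.symm b) := by
  constructor
  · rintro ⟨S, hS, ha, hb⟩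
    have := B.smul σ.symm hS
    have e : (σ.symm : Equiv.Perm ℕ) • σ • F = F := inv_smul_smul σ F
    rw [e] at this
    exact ⟨_, this, ⟨a, ha, rfl⟩, ⟨b, hb, rfl⟩⟩
  · rintro ⟨S, hS, ha, hb⟩
    exact ⟨_, B.smul σ hS, ⟨_, ha, by simp⟩, ⟨_, hb, by simp⟩⟩

theorem Comparable.mem {F : RForest} {a b : ℕ} (h : B.Comparable F a b) :
    a ∈ F.nodes ∧ b ∈ F.nodes := by
  obtain ⟨S, hS, ha, hb⟩ := h
  exact ⟨B.subset_nodes hS ha, B.subset_nodes hS hb⟩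

theorem Comparable.of_delRoot {t : RTree} {a b : ℕ} (h : B.Comparable t.delRoot a b) :
    B.Comparable t.toRForest a b := by
  obtain ⟨S, hS, ha, hb⟩ := h
  obtain ⟨S', hS', hs⟩ := B.delRoot hS
  exact ⟨S', hS', hs ha, hs hb⟩

theorem Comparable.of_restrict {F : RForest} {U : Finset ℕ} {hU : F.IsSubforest U} {a b : ℕ}
    (h : B.Comparable (F.restrict U hU) a b) : B.Comparable F a b := by
  obtain ⟨S, hS, ha, hb⟩ := h
  obtain ⟨S', hS', hs⟩ := B.restrict hU hS
  exact ⟨S', hS', hs ha, hs hb⟩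

theorem Comparable.left {t : RTree} {U : RForest} {d : ℕ → ℕ} {h : t.IsLink U d} {a b : ℕ}
    (hc : B.Comparable (t.attach U d h).toRForest a b) (ha : a ∈ t.nodes) (hb : b ∈ t.nodes) :
    B.Comparable t.toRForest a b := by
  obtain ⟨S, hS, ha', hb'⟩ := hc
  obtain ⟨S', hS', hs⟩ := B.attach_left h hS
  exact ⟨S', hS', hs ⟨ha', ha⟩, hs ⟨hb', hb⟩⟩

theorem Comparable.right {t : RTree} {U : RForest} {d : ℕ → ℕ} {h : t.IsLink U d} {a b : ℕ}
    (hc : B.Comparable (t.attach U d h).toRForest a b) (ha : a ∈ U.nodes) (hb : b ∈ U.nodes) :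
    B.Comparable U a b := by
  obtain ⟨S, hS, ha', hb'⟩ := hc
  obtain ⟨S', hS', hs⟩ := B.attach_right h hS
  exact ⟨S', hS', hs ⟨ha', ha⟩, hs ⟨hb', hb⟩⟩

theorem IsOrdering.induced {F G : RForest} {lt : ℕ → ℕ → Prop} (h : B.IsOrdering F lt)
    (hb : ∀ {S}, S ∈ B.blocks G → ∃ S' ∈ B.blocks F, S ⊆ S')
    (hp : ∀ v p, G.parent v = some p → F.parent v = some p) :
    B.IsOrdering G fun a b => B.Comparable G a b ∧ lt a b where
  comparable h := h.1
  irrefl a ha := h.irrefl a ha.2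
  trans := by
    intro S hS a b c ha hb' hc h1 h2
    obtain ⟨S', hS', hs⟩ := hb hS
    exact ⟨⟨S, hS, ha, hc⟩, h.trans hS' (hs ha) (hs hb') (hs hc) h1.2 h2.2⟩
  total := by
    intro S hS a b ha hb' hne
    obtain ⟨S', hS', hs⟩ := hb hS
    rcases h.total hS' (hs ha) (hs hb') hne with h1 | h1
    · exact Or.inl ⟨⟨S, hS, ha, hb'⟩, h1⟩
    · exact Or.inr ⟨⟨S, hS, hb', ha⟩, h1⟩
  ancestor := by
    rintro a b ⟨S, hS, ha, hb'⟩ hab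
    obtain ⟨S', hS', hs⟩ := hb hS
    exact ⟨⟨S, hS, ha, hb'⟩, h.ancestor ⟨S', hS', hs ha, hs hb'⟩ (hab.mono hp)⟩

theorem IsOrdering.smul {F : RForest} {lt : ℕ → ℕ → Prop} (h : B.IsOrdering F lt)
    (σ : Equiv.Perm ℕ) : B.IsOrdering (σ • F) fun a b => lt (σ.symm a) (σ.symm b) := by
  have key : ∀ {S}, S ∈ B.blocks (σ • F) → σ.symm '' S ∈ B.blocks F := by
    intro S hS
    have := B.smul σ.symm hS
    have e : (σ.symm : Equiv.Perm ℕ) • σ • F = F := inv_smul_smul σ F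
    rwa [e] at this
  exact
    { comparable := fun h1 => comparable_smul.2 (h.comparable h1)
      irrefl := fun a => h.irrefl _
      trans := fun hS _ _ _ ha hb hc h1 h2 =>
        h.trans (key hS) ⟨_, ha, rfl⟩ ⟨_, hb, rfl⟩ ⟨_, hc, rfl⟩ h1 h2
      total := fun hS _ _ ha hb hne =>
        h.total (key hS) ⟨_, ha, rfl⟩ ⟨_, hb, rfl⟩ (by simpa using hne)
      ancestor := fun hc ha => h.ancestor (comparable_smul.1 hc) (RForest.isAncestor_smul ha) }

theorem IsOrdering.mem {F : RForest} {lt : ℕ → ℕ → Prop} (h : B.IsOrdering F lt) {a b : ℕ}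
    (hab : lt a b) : a ∈ F.nodes ∧ b ∈ F.nodes := (h.comparable hab).mem

theorem IsOrdering.attach {t : RTree} {U : RForest} {d : ℕ → ℕ} (hl : t.IsLink U d)
    {lt lt' : ℕ → ℕ → Prop} (ht : B.IsOrdering t.toRForest lt) (hU : B.IsOrdering U lt') :
    B.IsOrdering (t.attach U d hl).toRForest fun a b =>
      B.Comparable (t.attach U d hl).toRForest a b ∧
        (lt a b ∨ lt' a b ∨ (a ∈ t.nodes ∧ b ∈ U.nodes)) := by
  have dis := Finset.disjoint_left.1 hl.1
  have hn : ∀ {S}, S ∈ B.blocks (t.attach U d hl).toRForest → ∀ a ∈ S, a ∈ t.nodes ∨ a ∈ U.nodes :=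
    fun hS a ha => Finset.mem_union.1 (B.subset_nodes hS ha)
  refine ⟨fun h => h.1, ?_, ?_, ?_, ?_⟩
  · rintro a ⟨-, h | h | h⟩
    · exact ht.irrefl _ h
    · exact hU.irrefl _ h
    · exact dis h.1 h.2
  · rintro S hS a b c ha hb hc ⟨-, h1⟩ ⟨-, h2⟩
    refine ⟨⟨S, hS, ha, hc⟩, ?_⟩
    obtain ⟨S₁, hS₁, hs₁⟩ := B.attach_left hl hS
    obtain ⟨S₂, hS₂, hs₂⟩ := B.attach_right hl hS
    rcases h1 with h1 | h1 | h1
    · have m1 := ht.mem h1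
      rcases h2 with h2 | h2 | h2
      · have m2 := ht.mem h2
        exact Or.inl (ht.trans hS₁ (hs₁ ⟨ha, m1.1⟩) (hs₁ ⟨hb, m1.2⟩) (hs₁ ⟨hc, m2.2⟩) h1 h2)
      · exact absurd (hU.mem h2).1 (dis m1.2)
      · exact Or.inr (Or.inr ⟨m1.1, h2.2⟩)
    · have m1 := hU.mem h1
      rcases h2 with h2 | h2 | h2
      · exact absurd m1.2 (dis (ht.mem h2).1)
      · have m2 := hU.mem h2
        exact Or.inr (Or.inl
          (hU.trans hS₂ (hs₂ ⟨ha, m1.1⟩) (hs₂ ⟨hb, m1.2⟩) (hs₂ ⟨hc, m2.2⟩) h1 h2))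
      · exact absurd m1.2 (dis h2.1)
    · rcases h2 with h2 | h2 | h2
      · exact absurd h1.2 (dis (ht.mem h2).1)
      · exact Or.inr (Or.inr ⟨h1.1, (hU.mem h2).2⟩)
      · exact absurd h1.2 (dis h2.1)
  · intro S hS a b ha hb hne
    obtain ⟨S₁, hS₁, hs₁⟩ := B.attach_left hl hS
    obtain ⟨S₂, hS₂, hs₂⟩ := B.attach_right hl hS
    have cab : B.Comparable (t.attach U d hl).toRForest a b := ⟨S, hS, ha, hb⟩
    have cba : B.Comparable (t.attach U d hl).toRForest b a := ⟨S, hS, hb, ha⟩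
    rcases hn hS a ha with h1 | h1 <;> rcases hn hS b hb with h2 | h2
    · rcases ht.total hS₁ (hs₁ ⟨ha, h1⟩) (hs₁ ⟨hb, h2⟩) hne with h | h
      · exact Or.inl ⟨cab, Or.inl h⟩
      · exact Or.inr ⟨cba, Or.inl h⟩
    · exact Or.inl ⟨cab, Or.inr (Or.inr ⟨h1, h2⟩)⟩
    · exact Or.inr ⟨cba, Or.inr (Or.inr ⟨h2, h1⟩)⟩
    · rcases hU.total hS₂ (hs₂ ⟨ha, h1⟩) (hs₂ ⟨hb, h2⟩) hne with h | h
      · exact Or.inl ⟨cab, Or.inr (Or.inl h)⟩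
      · exact Or.inr ⟨cba, Or.inr (Or.inl h)⟩
  · intro a b hc hab
    refine ⟨hc, ?_⟩
    have memt : ∀ a b, t.IsAncestor a b → a ∈ t.nodes ∧ b ∈ t.nodes := by
      intro a b hab
      induction hab with
      | single h => exact (t.mem_of_parent h).symm
      | tail _ h ih => exact ⟨ih.1, (t.mem_of_parent h).1⟩
    have memU : ∀ a b, U.IsAncestor a b → a ∈ U.nodes ∧ b ∈ U.nodes := by
      intro a b hab
      induction hab with
      | single h => exact (U.mem_of_parent h).symm
      | tail _ h ih => exact ⟨ih.1, (U.mem_of_parent h).1⟩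
    rcases RTree.IsAncestor_attach hl hab with h | h | h
    · exact Or.inl (ht.ancestor (hc.left (memt _ _ h).1 (memt _ _ h).2) h)
    · exact Or.inr (Or.inl (hU.ancestor (hc.right (memU _ _ h).1 (memU _ _ h).2) h))
    · exact Or.inr (Or.inr h)

instance : SMul (Equiv.Perm ℕ) B.OForest where
  smul σ V := ⟨σ • V.forest, fun a b => V.lt (σ.symm a) (σ.symm b), V.isOrdering.smul σ⟩

instance : SMul (Equiv.Perm ℕ) B.OTree where
  smul σ t := ⟨σ • t.tree, fun a b => t.lt (σ.symm a) (σ.symm b), t.isOrdering.smul σ⟩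

instance : MulAction (Equiv.Perm ℕ) B.OForest where
  one_smul V := OForest.ext (one_smul _ V.forest) rfl
  mul_smul σ τ V := OForest.ext (mul_smul σ τ V.forest) rfl

instance : MulAction (Equiv.Perm ℕ) B.OTree where
  one_smul t := OTree.ext (one_smul _ t.tree) rfl
  mul_smul σ τ t := OTree.ext (mul_smul σ τ t.tree) rfl

/-- Deleting the root of an ordered tree: the blocks keep the orderings that they had in the tree. -/
def OTree.delRoot (t : B.OTree) : B.OForest where
  forest := t.tree.delRoot
  lt a b := B.Comparable t.tree.delRoot a b ∧ t.lt a b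
  isOrdering := t.isOrdering.induced B.delRoot (by
    intro v p h
    simp only [RTree.delRoot] at h
    grind)

/-- Restriction to a subforest, whose blocks get the induced orderings. -/
noncomputable def OForest.restrict (V : B.OForest) (U : Finset ℕ) : B.OForest :=
  if hU : V.forest.IsSubforest U then
    { forest := V.forest.restrict U hU
      lt := fun a b => B.Comparable (V.forest.restrict U hU) a b ∧ V.lt a b
      isOrdering := V.isOrdering.induced (B.restrict hU) (by
        intro v p h
        simp only [RForest.restrict] at h
        grind) }
  else V

/-- Attachment: inside each block of the new tree the nodes of `t` precede the nodes of `U`, and the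
old and the new nodes keep their order among themselves. -/
noncomputable def OTree.attach (t : B.OTree) (U : B.OForest) (d : ℕ → ℕ) : B.OTree :=
  if h : t.tree.IsLink U.forest d then
    { tree := t.tree.attach U.forest d h
      lt := fun a b => B.Comparable (t.tree.attach U.forest d h).toRForest a b ∧
        (t.lt a b ∨ U.lt a b ∨ (a ∈ t.tree.nodes ∧ b ∈ U.forest.nodes))
      isOrdering := t.isOrdering.attach h U.isOrdering }
  else t

variable (B) in
theorem exists_ordering (F : RForest) : ∃ lt, B.IsOrdering F lt := by
  obtain ⟨ρ, hρ⟩ : ∃ ρ : ℕ → Ordinal.{0}, ∀ p v, F.parent v = some p → ρ p < ρ v :=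
    haveI : IsWellFounded ℕ fun p v => F.parent v = some p := ⟨F.wf⟩
    ⟨IsWellFounded.rank fun p v => F.parent v = some p,
      fun p v h => IsWellFounded.rank_lt_of_rel h⟩
  refine ⟨fun a b => B.Comparable F a b ∧
    (ρ a < ρ b ∨ ρ a = ρ b ∧ a < b), fun h => h.1, ?_, ?_, ?_, ?_⟩
  · rintro a ⟨-, h⟩
    simp at h
  · rintro S hS a b c ha hb hc ⟨-, h1⟩ ⟨-, h2⟩
    refine ⟨⟨S, hS, ha, hc⟩, ?_⟩
    rcases h1 with h1 | ⟨h1, h1'⟩ <;> rcases h2 with h2 | ⟨h2, h2'⟩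
    · exact Or.inl (h1.trans h2)
    · exact Or.inl (h2 ▸ h1)
    · exact Or.inl (h1 ▸ h2)
    · exact Or.inr ⟨h1.trans h2, h1'.trans h2'⟩
  · intro S hS a b ha hb hne
    rcases lt_trichotomy (ρ a) (ρ b) with h | h | h
    · exact Or.inl ⟨⟨S, hS, ha, hb⟩, Or.inl h⟩
    · rcases lt_or_gt_of_ne hne with h' | h'
      · exact Or.inl ⟨⟨S, hS, ha, hb⟩, Or.inr ⟨h, h'⟩⟩
      · exact Or.inr ⟨⟨S, hS, hb, ha⟩, Or.inr ⟨h.symm, h'⟩⟩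
    · exact Or.inr ⟨⟨S, hS, hb, ha⟩, Or.inl h⟩
  · intro a b hc hab
    refine ⟨hc, Or.inl ?_⟩
    clear hc
    induction hab with
    | single h => exact hρ _ _ h
    | tail _ h ih => exact ih.trans (hρ _ _ h)

end BlockSystem

theorem RForest.parent_eq_none_of_notMem {F : RForest} {v : ℕ} (h : v ∉ F.nodes) :
    F.parent v = none := by
  by_contra hne
  obtain ⟨p, hp⟩ := Option.ne_none_iff_exists'.1 hne
  exact h (F.mem_of_parent hp).1

namespace RTree

theorem isLink_smul {t : RTree} {U : RForest} {d : ℕ → ℕ} (h : t.IsLink U d)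
    (σ : Equiv.Perm ℕ) : (σ • t).IsLink (σ • U) fun v => σ (d (σ.symm v)) := by
  refine ⟨?_, fun v hv => ?_⟩
  · rw [toRForest_smul, RForest.nodes_smul, RForest.nodes_smul, Finset.disjoint_map]
    exact h.1
  · have hv' := RForest.mem_roots.1 hv
    rw [RForest.nodes_smul, Finset.mem_map_equiv, RForest.parent_smul,
      Option.map_eq_none_iff] at hv'
    rw [toRForest_smul, RForest.nodes_smul, Finset.mem_map_equiv]
    simpa using h.2 _ (RForest.mem_roots.2 hv')

theorem attach_smul {t : RTree} {U : RForest} {d : ℕ → ℕ} (h : t.IsLink U d)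
    (σ : Equiv.Perm ℕ) :
    (σ • t).attach (σ • U) (fun v => σ (d (σ.symm v))) (isLink_smul h σ) = σ • t.attach U d h := by
  refine ext' ?_
  ext1
  · exact (Finset.map_union _ _).symm
  · funext v
    have hr : v ∈ (σ • U).roots ↔ σ.symm v ∈ U.roots := by
      rw [RForest.mem_roots, RForest.mem_roots, RForest.nodes_smul, Finset.mem_map_equiv,
        RForest.parent_smul, Option.map_eq_none_iff]
    rw [toRForest_smul, RForest.parent_smul]
    simp only [attach, hr, toRForest_smul, RForest.nodes_smul, Finset.mem_map_equiv,
      RForest.parent_smul]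
    split_ifs <;> rfl

theorem delRoot_smul (t : RTree) (σ : Equiv.Perm ℕ) : (σ • t).delRoot = σ • t.delRoot := by
  ext1
  · simp [delRoot, RForest.nodes_smul, toRForest_smul, root_smul, Finset.map_erase]
  · funext v
    rw [RForest.parent_smul]
    simp only [delRoot, toRForest_smul, RForest.parent_smul, root_smul]
    cases h : t.parent (σ.symm v) <;> simp
    split_ifs <;> simp

theorem isLink_single {r : ℕ} {U : RForest} (h : r ∉ U.nodes) :
    (single r).IsLink U fun _ => r :=
  ⟨by simpa [single] using h, by simp [single]⟩

theorem isLink_single_delRoot (t : RTree) : (single t.root).IsLink t.delRoot fun _ => t.root :=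
  isLink_single (by simp [delRoot])

theorem single_attach_delRoot (t : RTree) :
    (single t.root).attach t.delRoot (fun _ => t.root) t.isLink_single_delRoot = t := by
  have h1 := t.root_mem
  have h2 := t.parent_root
  refine ext' ?_
  ext1
  · ext v
    simp only [attach, single, delRoot, Finset.mem_union, Finset.mem_erase, Finset.mem_singleton]
    grind
  · funext v
    have h3 := @t.parent_eq_none v
    have h4 := @t.mem_of_parent v
    simp only [attach, single, delRoot, Finset.mem_singleton, RForest.mem_roots, Finset.mem_erase]
    grind

theorem delRoot_single_attach {r : ℕ} {U : RForest} (h : r ∉ U.nodes) :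
    ((single r).attach U (fun _ => r) (isLink_single h)).delRoot = U := by
  ext1
  · ext v
    simp only [attach, single, delRoot, Finset.mem_union, Finset.mem_erase, Finset.mem_singleton]
    grind
  · funext v
    have h4 := @U.parent_eq_none_of_notMem v
    have h5 := @U.mem_of_parent v r
    simp only [attach, single, delRoot, Finset.mem_singleton, RForest.mem_roots]
    grind

theorem isLink_empty (t : RTree) (d : ℕ → ℕ) : t.IsLink RForest.empty d :=
  ⟨by simp [RForest.empty], by simp [RForest.empty, RForest.mem_roots]⟩

theorem attach_empty (t : RTree) (d : ℕ → ℕ) :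
    t.attach RForest.empty d (t.isLink_empty d) = t := by
  refine ext' ?_
  ext1
  · simp [attach, RForest.empty]
  · funext v
    have h4 := @t.parent_eq_none_of_notMem v
    simp only [attach, RForest.empty, RForest.mem_roots, Finset.notMem_empty]
    grind

theorem nodes_attach {t : RTree} {U : RForest} {d : ℕ → ℕ} (h : t.IsLink U d) :
    (t.attach U d h).nodes = t.nodes ∪ U.nodes := rfl

theorem root_attach {t : RTree} {U : RForest} {d : ℕ → ℕ} (h : t.IsLink U d) :
    (t.attach U d h).root = t.root := rfl

theorem parent_attach {t : RTree} {U : RForest} {d : ℕ → ℕ} (h : t.IsLink U d) (v : ℕ) :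
    (t.attach U d h).parent v =
      if v ∈ t.nodes then t.parent v else if v ∈ U.roots then some (d v) else U.parent v := rfl

theorem parent_delRoot (t : RTree) (v : ℕ) :
    t.delRoot.parent v = if t.parent v = some t.root then none else t.parent v := rfl

theorem nodes_delRoot (t : RTree) : t.delRoot.nodes = t.nodes.erase t.root := rfl

theorem mem_roots_delRoot {t : RTree} {v : ℕ} :
    v ∈ t.delRoot.roots ↔ t.parent v = some t.root := by
  rw [RForest.mem_roots]
  have h1 := t.parent_root
  have h2 := @RTree.parent_eq_none t v
  have h3 := @t.mem_of_parent v t.root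
  simp only [RTree.delRoot, Finset.mem_erase]
  grind

theorem isLink_attach_attach {t₁ t₂ t₃ : RTree} {d e : ℕ → ℕ}
    (h13 : Disjoint t₁.nodes t₃.nodes)
    (h23 : Disjoint t₂.nodes t₃.nodes) (hd : t₂.IsLink t₁.delRoot d)
    (he : t₃.IsLink (t₂.attach t₁.delRoot d hd).delRoot e) :
    ∃ hf : t₃.IsLink t₂.delRoot e, ∃ hg : (t₃.attach t₂.delRoot e hf).IsLink t₁.delRoot
      (fun s => if d s = t₂.root then e s else d s), 
      t₃.attach (t₂.attach t₁.delRoot d hd).delRoot e he =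
        (t₃.attach t₂.delRoot e hf).attach t₁.delRoot _ hg := by
  have d1 := Finset.disjoint_left.1 hd.1
  have d2 := Finset.disjoint_left.1 he.1
  have d3 := Finset.disjoint_left.1 h13
  have d4 := Finset.disjoint_left.1 h23
  have r2 := t₂.root_mem
  have r2' := t₂.parent_root
  have r3 := t₃.root_mem
  have hr : ∀ v, v ∈ (t₂.attach t₁.delRoot d hd).delRoot.roots ↔
      v ∈ t₂.delRoot.roots ∨ v ∈ t₁.delRoot.roots ∧ d v = t₂.root := by
    intro v
    rw [mem_roots_delRoot, mem_roots_delRoot, root_attach]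
    have h3 := @t₂.mem_of_parent v t₂.root
    have h4 := @t₁.delRoot.mem_of_parent v t₂.root
    have h5 := @RForest.mem_roots t₁.delRoot v
    simp only [attach]
    grind
  have hf : t₃.IsLink t₂.delRoot e := by
    refine ⟨?_, fun v hv => he.2 v ((hr v).2 (Or.inl hv))⟩
    rw [nodes_delRoot]
    exact h23.symm.mono_right (Finset.erase_subset _ _)
  have hg : (t₃.attach t₂.delRoot e hf).IsLink t₁.delRoot
      (fun s => if d s = t₂.root then e s else d s) := by
    constructor
    · rw [nodes_attach, Finset.disjoint_left]
      simp only [nodes_delRoot, Finset.mem_union, Finset.mem_erase] at d1 ⊢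
      grind
    · intro v hv
      have h1 := he.2 v
      rw [hr] at h1
      have h2 := hd.2 v hv
      rw [nodes_attach]
      simp only [nodes_delRoot, Finset.mem_union, Finset.mem_erase]
      grind
  refine ⟨hf, hg, ?_⟩
  refine ext' ?_
  ext1
  · ext v
    simp only [nodes_attach, nodes_delRoot, Finset.mem_union, Finset.mem_erase, root_attach]
    have := d1 (a := t₂.root)
    simp only [nodes_delRoot, Finset.mem_erase] at this
    grind
  · funext v
    have hr' := hr v
    simp only [parent_attach, hr, parent_delRoot, nodes_attach, root_attach, nodes_delRoot,
      Finset.mem_union, Finset.mem_erase]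
    have h6 := @t₂.mem_of_parent v
    have h7 := @t₁.mem_of_parent v
    have h8 := @t₂.parent_eq_none v
    have h10 := @t₂.parent_eq_none_of_notMem v
    have h11 := @mem_roots_delRoot t₂ v
    simp only [nodes_delRoot, Finset.mem_erase] at d1
    have h9 := @mem_roots_delRoot t₁ v
    have h12 := hd.2 v
    have h13 := @t₁.parent_eq_none v
    have h14 := @t₁.parent_eq_none_of_notMem v
    grind

theorem attach_restrict {t : RTree} {X : RForest} {d : ℕ → ℕ} {U : Finset ℕ}
    (hd : t.IsLink X d) (hU : (t.attach X d hd).delRoot.IsSubforest U) :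
    ∃ (h1 : (single t.root).IsLink ((t.attach X d hd).delRoot.restrict U hU) fun _ => t.root)
      (h2 : t.delRoot.IsSubforest (U ∩ t.nodes)) (h3 : X.IsSubforest (U ∩ X.nodes))
      (h4 : (single t.root).IsLink (t.delRoot.restrict _ h2) fun _ => t.root)
      (h5 : ((single t.root).attach (t.delRoot.restrict _ h2) _ h4).IsLink (X.restrict _ h3) d),
      (single t.root).attach ((t.attach X d hd).delRoot.restrict U hU) _ h1 =
        ((single t.root).attach (t.delRoot.restrict _ h2) _ h4).attach (X.restrict _ h3) d h5 := by
  have d1 := Finset.disjoint_left.1 hd.1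
  have r1 := t.root_mem
  have r2 := t.parent_root
  obtain ⟨hU1, hU2⟩ := id hU
  have hU1' : ∀ v ∈ U, v ≠ t.root ∧ (v ∈ t.nodes ∨ v ∈ X.nodes) := by
    intro v hv
    have := hU1 hv
    rw [nodes_delRoot, nodes_attach, root_attach] at this
    simpa using this
  have hX : ∀ v p, X.parent v = some p → (v ∈ U ↔ p ∈ U) := by
    intro v p hvp
    have h1 := X.mem_of_parent hvp
    refine hU2 v p ?_
    have h3 := @RForest.mem_roots X v
    simp only [delRoot, attach]
    grind
  have ht : ∀ v p, t.parent v = some p → p ≠ t.root → (v ∈ U ↔ p ∈ U) := by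
    intro v p hvp hp
    have h1 := t.mem_of_parent hvp
    refine hU2 v p ?_
    simp only [delRoot, attach]
    grind
  have hdU : ∀ v ∈ X.roots, d v ≠ t.root → (v ∈ U ↔ d v ∈ U) := by
    intro v hv hp
    refine hU2 v _ ?_
    have h3 := @RForest.mem_roots X v
    simp only [delRoot, attach]
    grind
  have h1 : (single t.root).IsLink ((t.attach X d hd).delRoot.restrict U hU) fun _ => t.root :=
    isLink_single fun h => (hU1' _ h).1 rfl
  have h2 : t.delRoot.IsSubforest (U ∩ t.nodes) := by
    refine ⟨?_, ?_⟩
    · intro v hv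
      rw [nodes_delRoot]
      grind
    · intro v p hvp
      have := t.delRoot.mem_of_parent hvp
      simp only [delRoot, Finset.mem_erase] at hvp this
      have := ht v p
      grind
  have h3 : X.IsSubforest (U ∩ X.nodes) := by
    refine ⟨Finset.inter_subset_right, ?_⟩
    intro v p hvp
    have := X.mem_of_parent hvp
    have := hX v p hvp
    grind
  have h4 : (single t.root).IsLink (t.delRoot.restrict _ h2) fun _ => t.root :=
    isLink_single fun h => (hU1' _ (Finset.mem_inter.1 h).1).1 rfl
  have hrX : ∀ v, v ∈ (X.restrict _ h3).roots ↔ v ∈ U ∧ v ∈ X.roots := by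
    intro v
    simp only [RForest.mem_roots, RForest.restrict, Finset.mem_inter]
    grind
  have h5 : ((single t.root).attach (t.delRoot.restrict _ h2) _ h4).IsLink
      (X.restrict _ h3) d := by
    constructor
    · rw [nodes_attach, Finset.disjoint_left]
      simp only [RForest.restrict, single]
      grind
    · intro v hv
      rw [hrX] at hv
      have := hdU v hv.2
      have := hd.2 v hv.2
      rw [nodes_attach]
      simp only [RForest.restrict, single]
      grind
  refine ⟨h1, h2, h3, h4, h5, ?_⟩
  refine ext' ?_
  ext1
  · ext v
    have := hU1' v
    simp only [nodes_attach, RForest.restrict, single]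
    grind
  · funext v
    have a1 := hU1' v
    have a3 := @X.mem_of_parent v
    have a4 := @t.mem_of_parent v
    have a5 := hd.2 v
    have a6 := @t.parent_eq_none v
    have a7 := ht v
    have a8 := hX v
    simp only [RForest.mem_roots] at a5
    simp only [attach, RForest.restrict, single, delRoot, RForest.mem_roots, Finset.mem_union,
      Finset.mem_singleton, Finset.mem_inter]
    grind

end RTree

namespace BlockSystem
variable {B : BlockSystem}

theorem OForest.restrict_of {V : B.OForest} {U : Finset ℕ} (hU : V.forest.IsSubforest U) :
    V.restrict U =
    { forest := V.forest.restrict U hU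
      lt := fun a b => B.Comparable (V.forest.restrict U hU) a b ∧ V.lt a b
      isOrdering := V.isOrdering.induced (B.restrict hU) (by
        intro v p h
        simp only [RForest.restrict] at h
        grind) } := dif_pos hU

theorem OTree.attach_of {t : B.OTree} {U : B.OForest} {d : ℕ → ℕ}
    (h : t.tree.IsLink U.forest d) : t.attach U d =
    { tree := t.tree.attach U.forest d h
      lt := fun a b => B.Comparable (t.tree.attach U.forest d h).toRForest a b ∧
        (t.lt a b ∨ U.lt a b ∨ (a ∈ t.tree.nodes ∧ b ∈ U.forest.nodes))
      isOrdering := t.isOrdering.attach h U.isOrdering } := dif_pos h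

theorem isSubforest_smul {F : RForest} {U : Finset ℕ} (hU : F.IsSubforest U)
    (σ : Equiv.Perm ℕ) : (σ • F).IsSubforest (U.map σ.toEmbedding) := by
  refine ⟨Finset.map_subset_map.2 hU.1, ?_⟩
  intro v p h
  obtain ⟨q, hq, rfl⟩ := Option.map_eq_some_iff.1 h
  have := hU.2 _ _ hq
  rw [Finset.mem_map_equiv, Finset.mem_map_equiv, this]
  simp

theorem restrict_smul {F : RForest} {U : Finset ℕ} (hU : F.IsSubforest U)
    (σ : Equiv.Perm ℕ) : (σ • F).restrict _ (isSubforest_smul hU σ) = σ • F.restrict U hU := by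
  ext1
  · rfl
  · funext v
    rw [RForest.parent_smul]
    simp only [RForest.restrict, Finset.mem_map_equiv, RForest.parent_smul]
    split_ifs <;> rfl

theorem smul_eq_of_fix {F : RForest} {σ : Equiv.Perm ℕ} (h : ∀ v ∈ F.nodes, σ v = v) :
    σ • F = F := by
  have hs : ∀ v, v ∈ F.nodes → σ.symm v = v := fun v hv => by
    rw [Equiv.symm_apply_eq, h v hv]
  have hn : ∀ v, σ.symm v ∈ F.nodes ↔ v ∈ F.nodes := by
    intro v
    constructor
    · intro hv
      have := h _ hv
      rw [Equiv.apply_symm_apply] at this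
      rwa [← this] at hv
    · intro hv
      rwa [hs v hv]
  ext1
  · ext v
    rw [RForest.nodes_smul, Finset.mem_map_equiv, hn]
  · funext v
    rw [RForest.parent_smul]
    by_cases hv : v ∈ F.nodes
    · rw [hs v hv]
      cases hp : F.parent v with
      | none => rfl
      | some p => simp [h p (F.mem_of_parent hp).2]
    · rw [RForest.parent_eq_none_of_notMem hv,
        RForest.parent_eq_none_of_notMem (fun h => hv ((hn v).1 h))]
      rfl

theorem lt_smul_of_fix {F : RForest} {σ : Equiv.Perm ℕ} (h : ∀ v ∈ F.nodes, σ v = v)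
    {lt : ℕ → ℕ → Prop} (hl : B.IsOrdering F lt) :
    (fun a b => lt (σ.symm a) (σ.symm b)) = lt := by
  have hs : ∀ v, v ∈ F.nodes → σ.symm v = v := fun v hv => by
    rw [Equiv.symm_apply_eq, h v hv]
  funext a b
  refine propext ⟨fun hab => ?_, fun hab => ?_⟩
  · have m := hl.mem hab
    have h1 := h _ m.1
    have h2 := h _ m.2
    rw [Equiv.apply_symm_apply] at h1 h2
    rwa [← h1, ← h2] at hab
  · have m := hl.mem hab
    rwa [hs _ m.1, hs _ m.2]

theorem OTree.ext_of {s t : B.OTree} (h : s.tree = t.tree)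
    (hlt : ∀ a b, B.Comparable s.tree.toRForest a b → (s.lt a b ↔ t.lt a b)) : s = t := by
  refine OTree.ext h ?_
  funext a b
  refine propext ⟨fun hab => ?_, fun hab => ?_⟩
  · exact (hlt a b (s.isOrdering.comparable hab)).1 hab
  · exact (hlt a b (h ▸ t.isOrdering.comparable hab)).2 hab

theorem OForest.ext_of {s t : B.OForest} (h : s.forest = t.forest)
    (hlt : ∀ a b, B.Comparable s.forest a b → (s.lt a b ↔ t.lt a b)) : s = t := by
  refine OForest.ext h ?_
  funext a b
  refine propext ⟨fun hab => ?_, fun hab => ?_⟩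
  · exact (hlt a b (s.isOrdering.comparable hab)).1 hab
  · exact (hlt a b (h ▸ t.isOrdering.comparable hab)).2 hab

variable (B) in
noncomputable def familyData : FamilyData.{0} where
  Tree := B.OTree
  Forest := B.OForest
  treeAction := inferInstance
  forestAction := inferInstance
  under := OTree.tree
  underF := OForest.forest
  delRoot := OTree.delRoot
  restrict := OForest.restrict
  attach := OTree.attach

theorem not_lt_single {e : B.OTree} {r : ℕ} (h : e.tree = RTree.single r) (a b : ℕ) :
    ¬ e.lt a b := by
  intro hab
  have m := e.isOrdering.mem hab
  rw [h] at m
  simp only [RTree.single, Finset.mem_singleton] at m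
  rw [m.1, m.2] at hab
  exact e.isOrdering.irrefl _ hab

theorem not_lt_empty {V : B.OForest} (h : V.forest = RForest.empty) (a b : ℕ) :
    ¬ V.lt a b := by
  intro hab
  have m := V.isOrdering.mem hab
  rw [h] at m
  simp [RForest.empty] at m

theorem root_isAncestor (t : RTree) {v : ℕ} (hv : v ∈ t.nodes) (hne : v ≠ t.root) :
    t.IsAncestor t.root v := by
  induction v using t.wf.induction with
  | _ v ih =>
    obtain ⟨p, hp⟩ := Option.ne_none_iff_exists'.1 (fun h => hne ((RTree.parent_eq_none hv).1 h))
    by_cases hpr : p = t.root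
    · subst hpr
      exact .single hp
    · exact .tail (ih p hp (t.mem_of_parent hp).2 hpr) hp

theorem OTree.tree_attach {t : B.OTree} {U : B.OForest} {d : ℕ → ℕ}
    (h : t.tree.IsLink U.forest d) : (t.attach U d).tree = t.tree.attach U.forest d h := by
  rw [OTree.attach_of h]

theorem OTree.lt_attach {t : B.OTree} {U : B.OForest} {d : ℕ → ℕ}
    (h : t.tree.IsLink U.forest d) (a b : ℕ) : (t.attach U d).lt a b ↔
      B.Comparable (t.attach U d).tree.toRForest a b ∧
        (t.lt a b ∨ U.lt a b ∨ (a ∈ t.tree.nodes ∧ b ∈ U.forest.nodes)) := by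
  rw [OTree.attach_of h]

theorem OTree.mem_attach {t : B.OTree} {U : B.OForest} {d : ℕ → ℕ}
    (h : t.tree.IsLink U.forest d) (a : ℕ) : a ∈ (t.attach U d).tree.nodes ↔
      a ∈ t.tree.nodes ∨ a ∈ U.forest.nodes := by
  rw [OTree.attach_of h]
  exact Finset.mem_union

theorem OTree.root_attach {t : B.OTree} {U : B.OForest} {d : ℕ → ℕ}
    (h : t.tree.IsLink U.forest d) : (t.attach U d).tree.root = t.tree.root := by
  rw [OTree.attach_of h]
  rfl

theorem OTree.attach_left {t : B.OTree} {U : B.OForest} {d : ℕ → ℕ}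
    (h : t.tree.IsLink U.forest d) {a b : ℕ}
    (hc : B.Comparable (t.attach U d).tree.toRForest a b) (ha : a ∈ t.tree.nodes)
    (hb : b ∈ t.tree.nodes) : B.Comparable t.tree.toRForest a b := by
  rw [tree_attach h] at hc
  exact hc.left ha hb

theorem OTree.attach_right {t : B.OTree} {U : B.OForest} {d : ℕ → ℕ}
    (h : t.tree.IsLink U.forest d) {a b : ℕ}
    (hc : B.Comparable (t.attach U d).tree.toRForest a b) (ha : a ∈ U.forest.nodes)
    (hb : b ∈ U.forest.nodes) : B.Comparable U.forest a b := by
  rw [tree_attach h] at hc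
  exact hc.right ha hb

theorem OTree.lt_delRoot {t : B.OTree} (a b : ℕ) :
    t.delRoot.lt a b ↔ B.Comparable t.delRoot.forest a b ∧ t.lt a b := Iff.rfl

theorem OTree.mem_delRoot {t : B.OTree} (a : ℕ) :
    a ∈ t.delRoot.forest.nodes ↔ a ≠ t.tree.root ∧ a ∈ t.tree.nodes := Finset.mem_erase

theorem OTree.of_delRoot {t : B.OTree} {a b : ℕ} (h : B.Comparable t.delRoot.forest a b) :
    B.Comparable t.tree.toRForest a b := Comparable.of_delRoot h

theorem OForest.forest_restrict {V : B.OForest} {U : Finset ℕ} (hU : V.forest.IsSubforest U) :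
    (V.restrict U).forest = V.forest.restrict U hU := by
  rw [OForest.restrict_of hU]

theorem OForest.mem_restrict {V : B.OForest} {U : Finset ℕ} (hU : V.forest.IsSubforest U)
    (a : ℕ) : a ∈ (V.restrict U).forest.nodes ↔ a ∈ U := by
  rw [OForest.restrict_of hU]
  rfl

theorem OForest.lt_restrict {V : B.OForest} {U : Finset ℕ} (hU : V.forest.IsSubforest U)
    (a b : ℕ) :
    (V.restrict U).lt a b ↔ B.Comparable (V.restrict U).forest a b ∧ V.lt a b := by
  rw [OForest.restrict_of hU]

theorem OForest.of_restrict {V : B.OForest} {U : Finset ℕ} (hU : V.forest.IsSubforest U)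
    {a b : ℕ} (h : B.Comparable (V.restrict U).forest a b) : B.Comparable V.forest a b := by
  rw [forest_restrict hU] at h
  exact h.of_restrict

theorem OTree.mem_of_lt {t : B.OTree} {a b : ℕ} (h : t.lt a b) :
    a ∈ t.tree.nodes ∧ b ∈ t.tree.nodes := t.isOrdering.mem h

theorem OForest.mem_of_lt {t : B.OForest} {a b : ℕ} (h : t.lt a b) :
    a ∈ t.forest.nodes ∧ b ∈ t.forest.nodes := t.isOrdering.mem h

theorem attach_congr_of_eq {t t' : RTree} {U U' : RForest} {d : ℕ → ℕ} (h : t.IsLink U d)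
    (h' : t'.IsLink U' d) (ht : t = t') (hU : U = U') : t.attach U d h = t'.attach U' d h' := by
  subst ht hU
  rfl

theorem OTree.attach_attach {t₁ t₂ t₃ : B.OTree} {d e : ℕ → ℕ}
    (h12 : Disjoint t₁.tree.nodes t₂.tree.nodes)
    (h13 : Disjoint t₁.tree.nodes t₃.tree.nodes) (h23 : Disjoint t₂.tree.nodes t₃.tree.nodes)
    (hd : t₂.tree.IsLink t₁.delRoot.forest d)
    (he : t₃.tree.IsLink (t₂.attach t₁.delRoot d).delRoot.forest e) :
    t₃.attach (t₂.attach t₁.delRoot d).delRoot e =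
      (t₃.attach t₂.delRoot e).attach t₁.delRoot
        (fun s => if d s = t₂.tree.root then e s else d s) := by
  have he' : t₃.tree.IsLink (t₂.tree.attach t₁.tree.delRoot d hd).delRoot e := by
    have : (t₂.attach t₁.delRoot d).delRoot.forest =
      (t₂.tree.attach t₁.tree.delRoot d hd).delRoot := congrArg RTree.delRoot (tree_attach hd)
    rwa [this] at he
  obtain ⟨hf, hg, es⟩ := RTree.isLink_attach_attach h13 h23 hd he'
  have hg' : (t₃.attach t₂.delRoot e).tree.IsLink t₁.delRoot.forest
      (fun s => if d s = t₂.tree.root then e s else d s) := by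
    rw [OTree.tree_attach (t := t₃) (U := t₂.delRoot) hf]
    exact hg
  have es' : (t₃.attach (t₂.attach t₁.delRoot d).delRoot e).tree =
      ((t₃.attach t₂.delRoot e).attach t₁.delRoot
      (fun s => if d s = t₂.tree.root then e s else d s)).tree :=
    (tree_attach he).trans <|
      (attach_congr_of_eq he he' rfl (congrArg RTree.delRoot (tree_attach hd))).trans <|
      es.trans <| (attach_congr_of_eq hg hg' (OTree.tree_attach (U := t₂.delRoot) hf).symm
        rfl).trans (tree_attach hg').symm
  refine OTree.ext_of es' fun a b hcL => ?_
  · have hcR := hcL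
    rw [es'] at hcR
    have m := hcL.mem
    have c2 := attach_right he hcL
    have c3 := fun ha hb => of_delRoot (c2 ha hb)
    have c4 := fun ha hb ha' hb' => attach_right hd (c3 ha hb) ha' hb'
    have c5 := attach_left hg' hcR
    have c6 := attach_right hg' hcR
    have c7 := fun ha hb => attach_left (t := t₃) (U := t₂.delRoot) hf (c5 ha hb)
    have c8 := fun ha hb => attach_right (t := t₃) (U := t₂.delRoot) hf (c5 ha hb)
    have l1 := fun h => t₁.mem_of_lt (a := a) (b := b) h
    have l2 := fun h => t₂.mem_of_lt (a := a) (b := b) h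
    have l3 := fun h => t₃.mem_of_lt (a := a) (b := b) h
    have d1 := Finset.disjoint_left.1 h12
    have d2 := Finset.disjoint_left.1 h13
    have d3 := Finset.disjoint_left.1 h23
    rw [lt_attach he, lt_attach hg', lt_attach (t := t₃) (U := t₂.delRoot) hf, lt_delRoot,
      lt_delRoot, lt_delRoot, lt_attach hd, lt_delRoot]
    simp only [mem_attach he, mem_attach (t := t₃) (U := t₂.delRoot) hf, mem_attach hd,
      mem_delRoot, root_attach hd] at *
    grind

theorem OTree.attach_restrict {t e : B.OTree} {X : B.OForest} {d : ℕ → ℕ} {U : Finset ℕ}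
    (hd : t.tree.IsLink X.forest d)
    (hU : (t.attach X d).delRoot.forest.IsSubforest U) (he : e.tree = RTree.single t.tree.root) :
    e.attach ((t.attach X d).delRoot.restrict U) (fun _ => t.tree.root) =
      (e.attach (t.delRoot.restrict (U ∩ t.tree.nodes)) (fun _ => t.tree.root)).attach
        (X.restrict (U ∩ X.forest.nodes)) d := by
  have hU' : (t.tree.attach X.forest d hd).delRoot.IsSubforest U := by
    have : (t.attach X d).delRoot.forest = (t.tree.attach X.forest d hd).delRoot :=
      congrArg RTree.delRoot (tree_attach hd)
    rwa [this] at hU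
  obtain ⟨h1, h2, h3, h4, h5, es⟩ := RTree.attach_restrict hd hU'
  have e1 : ((t.attach X d).delRoot.restrict U).forest =
      (t.tree.attach X.forest d hd).delRoot.restrict U hU' := by
    rw [OForest.forest_restrict hU]
    have : (t.attach X d).delRoot.forest = (t.tree.attach X.forest d hd).delRoot :=
      congrArg RTree.delRoot (tree_attach hd)
    simp only [this]
  have e2 : (t.delRoot.restrict (U ∩ t.tree.nodes)).forest = t.tree.delRoot.restrict _ h2 :=
    OForest.forest_restrict (V := t.delRoot) h2
  have e3 : (X.restrict (U ∩ X.forest.nodes)).forest = X.forest.restrict _ h3 :=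
    OForest.forest_restrict h3
  have h1' : e.tree.IsLink ((t.attach X d).delRoot.restrict U).forest fun _ => t.tree.root := by
    rwa [he, e1]
  have h4' : e.tree.IsLink (t.delRoot.restrict (U ∩ t.tree.nodes)).forest
      fun _ => t.tree.root := by
    rwa [he, e2]
  have e4 : (e.attach (t.delRoot.restrict (U ∩ t.tree.nodes)) (fun _ => t.tree.root)).tree =
      (RTree.single t.tree.root).attach (t.tree.delRoot.restrict _ h2) _ h4 :=
    (tree_attach h4').trans (attach_congr_of_eq _ _ he e2)
  have h5' : (e.attach (t.delRoot.restrict (U ∩ t.tree.nodes)) (fun _ => t.tree.root)).tree.IsLink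
      (X.restrict (U ∩ X.forest.nodes)).forest d := by
    rwa [e4, e3]
  have es' : (e.attach ((t.attach X d).delRoot.restrict U) (fun _ => t.tree.root)).tree =
      ((e.attach (t.delRoot.restrict (U ∩ t.tree.nodes)) (fun _ => t.tree.root)).attach
        (X.restrict (U ∩ X.forest.nodes)) d).tree :=
    (tree_attach h1').trans <| (attach_congr_of_eq _ _ he e1).trans <| es.trans <|
      (attach_congr_of_eq _ _ e4 e3).symm.trans (tree_attach h5').symm
  refine OTree.ext_of es' fun a b hcL => ?_
  have hcR := hcL
  rw [es'] at hcR
  have m := hcL.mem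
  have ne := not_lt_single he a b
  have c1 := attach_right h1' hcL
  have c2 := fun ha hb => OForest.of_restrict hU (c1 ha hb)
  have c3 := fun ha hb => of_delRoot (c2 ha hb)
  have c5 := attach_left h5' hcR
  have c6 := attach_right h5' hcR
  have c7 := fun ha hb => attach_right h4' (c5 ha hb)
  have c8 := fun ha hb ha' hb' => OForest.of_restrict (V := t.delRoot) h2 (c7 ha hb ha' hb')
  have k1 := Comparable.mem (B := B) (F := ((t.attach X d).delRoot.restrict U).forest)
    (a := a) (b := b)
  have k2 := Comparable.mem (B := B) (F := (t.delRoot.restrict (U ∩ t.tree.nodes)).forest)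
    (a := a) (b := b)
  have k3 := Comparable.mem (B := B) (F := (X.restrict (U ∩ X.forest.nodes)).forest)
    (a := a) (b := b)
  have l1 := fun h => t.mem_of_lt (a := a) (b := b) h
  have l2 := fun h => X.mem_of_lt (a := a) (b := b) h
  have d1 := Finset.disjoint_left.1 hd.1
  have hU1 : ∀ v ∈ U, v ∈ (t.attach X d).delRoot.forest.nodes := fun v hv => hU.1 hv
  have hs : ∀ v, v ∈ e.tree.nodes ↔ v = t.tree.root := by
    intro v
    rw [he]
    exact Finset.mem_singleton
  rw [lt_attach h1', lt_attach h5', lt_attach h4', OForest.lt_restrict hU,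
    OForest.lt_restrict (V := t.delRoot) h2, OForest.lt_restrict h3, lt_delRoot, lt_delRoot,
    lt_attach hd]
  simp only [mem_attach h1', mem_attach h4', mem_attach hd, mem_delRoot,
    root_attach hd, OForest.mem_restrict hU, OForest.mem_restrict (V := t.delRoot) h2,
    OForest.mem_restrict h3, Finset.mem_inter, hs] at c1 c2 c3 c5 c6 c7 c8 m d1 hU1 k1 k2 k3 ⊢
  have hr : t.tree.root ∉ U := fun h => (hU1 _ h).1 rfl
  grind

variable (B) in
noncomputable def family : Family.{0} where
  toFamilyData := B.familyData
  under_smul _ _ := rfl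
  underF_smul _ _ := rfl
  smul_eq_of_fix σ t h :=
    OTree.ext (RTree.ext' (smul_eq_of_fix h)) (lt_smul_of_fix h t.isOrdering)
  smulF_eq_of_fix σ V h := OForest.ext (smul_eq_of_fix h) (lt_smul_of_fix h V.isOrdering)
  delRoot_smul := by
    intro σ (t : B.OTree)
    refine OForest.ext (RTree.delRoot_smul t.tree σ) ?_
    funext a b
    change (B.Comparable (σ • t.tree).delRoot a b ∧ _) = (B.Comparable t.tree.delRoot _ _ ∧ _)
    rw [RTree.delRoot_smul, comparable_smul]
    rfl
  restrict_smul := by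
    intro σ (V : B.OForest) U (hU : V.forest.IsSubforest U)
    change OForest.restrict (σ • V) _ = σ • OForest.restrict V U
    rw [OForest.restrict_of hU, OForest.restrict_of (V := σ • V) (isSubforest_smul hU σ)]
    refine OForest.ext (restrict_smul hU σ) ?_
    funext a b
    change (B.Comparable ((σ • V.forest).restrict _ _) a b ∧ _) = (B.Comparable _ _ _ ∧ _)
    rw [restrict_smul hU σ, comparable_smul]
    rfl
  attach_smul := by
    intro σ (t : B.OTree) (U : B.OForest) d (h : t.tree.IsLink U.forest d)
    change OTree.attach (σ • t) (σ • U) _ = σ • OTree.attach t U d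
    rw [OTree.attach_of h, OTree.attach_of (t := σ • t) (U := σ • U) (RTree.isLink_smul h σ)]
    refine OTree.ext (RTree.attach_smul h σ) ?_
    funext a b
    change (B.Comparable ((σ • t.tree).attach (σ • U.forest) _ _).toRForest a b ∧
      (_ ∨ _ ∨ (a ∈ (σ • t.tree).nodes ∧ b ∈ (σ • U.forest).nodes))) = (B.Comparable _ _ _ ∧ _)
    rw [RTree.attach_smul h σ, RTree.toRForest_smul, comparable_smul, RTree.toRForest_smul,
      RForest.nodes_smul, RForest.nodes_smul, Finset.mem_map_equiv, Finset.mem_map_equiv]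
    rfl
  attach_congr := by
    intro (t : B.OTree) (U : B.OForest) d d' (h : t.tree.IsLink U.forest d)
      (hd : ∀ v ∈ U.forest.roots, d v = d' v)
    have h' : t.tree.IsLink U.forest d' := ⟨h.1, fun v hv => hd v hv ▸ h.2 v hv⟩
    have e : t.tree.attach U.forest d h = t.tree.attach U.forest d' h' := by
      refine RTree.ext' ?_
      ext1
      · rfl
      · funext v
        have := hd v
        simp only [RTree.parent_attach]
        grind
    change OTree.attach t U d = OTree.attach t U d'
    rw [OTree.attach_of h, OTree.attach_of h']
    refine OTree.ext e ?_
    simp only [e]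
  underF_delRoot _ := rfl
  exists_tree T := ⟨⟨T, (B.exists_ordering T.toRForest).choose,
    (B.exists_ordering T.toRForest).choose_spec⟩, rfl⟩
  exists_forest F := ⟨⟨F, (B.exists_ordering F).choose, (B.exists_ordering F).choose_spec⟩, rfl⟩
  restrict_self := by
    intro (V : B.OForest)
    have hU : V.forest.IsSubforest V.forest.nodes :=
      ⟨subset_rfl, fun v p h => by have := V.forest.mem_of_parent h; tauto⟩
    have e : V.forest.restrict _ hU = V.forest := by
      ext1
      · rfl
      · funext v
        have := @V.forest.parent_eq_none_of_notMem v
        simp only [RForest.restrict]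
        grind
    change OForest.restrict V V.forest.nodes = V
    rw [OForest.restrict_of hU]
    refine OForest.ext_of e fun a b h => ?_
    simp only at h ⊢
    tauto
  underF_restrict := by
    intro (V : B.OForest) U (hU : V.forest.IsSubforest U)
    change (OForest.restrict V U).forest = V.forest.restrict U hU
    rw [OForest.restrict_of hU]
  restrict_restrict := by
    intro (W : B.OForest) U V (hU : W.forest.IsSubforest U) (hV : W.forest.IsSubforest V) hUV
    have hUV' : (W.forest.restrict V hV).IsSubforest U := by
      refine ⟨hUV, fun v p h => ?_⟩
      have := hU.2 v p
      simp only [RForest.restrict] at h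
      grind
    have e : W.forest.restrict U hU = (W.forest.restrict V hV).restrict U hUV' := by
      ext1
      · rfl
      · funext v
        simp only [RForest.restrict]
        grind
    change OForest.restrict W U = OForest.restrict (OForest.restrict W V) U
    rw [OForest.restrict_of hU, OForest.restrict_of hV,
      OForest.restrict_of (V := ⟨W.forest.restrict V hV, _, _⟩) hUV']
    refine OForest.ext_of e fun a b h => ?_
    simp only at h ⊢
    rw [e] at h ⊢
    have := h.of_restrict
    tauto
  under_attach := by
    intro (t : B.OTree) (U : B.OForest) d (h : t.tree.IsLink U.forest d)
    change (OTree.attach t U d).tree = _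
    rw [OTree.attach_of h]
    rfl
  existsUnique_single := by
    intro r
    refine ⟨⟨RTree.single r, (B.exists_ordering (RTree.single r).toRForest).choose,
      (B.exists_ordering (RTree.single r).toRForest).choose_spec⟩, rfl, ?_⟩
    intro (e : B.OTree) (he : e.tree = _)
    refine OTree.ext_of he fun a b _ => iff_of_false (not_lt_single he a b) ?_
    exact not_lt_single rfl a b
  existsUnique_empty := by
    refine ⟨⟨RForest.empty, (B.exists_ordering RForest.empty).choose,
      (B.exists_ordering RForest.empty).choose_spec⟩, rfl, ?_⟩
    intro (e : B.OForest) (he : e.forest = _)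
    refine OForest.ext_of he fun a b _ => iff_of_false (not_lt_empty he a b) ?_
    exact not_lt_empty rfl a b
  attach_single_delRoot := by
    intro (t : B.OTree) (e : B.OTree) (he : e.tree = RTree.single t.tree.root)
    have hl : e.tree.IsLink t.delRoot.forest fun _ => t.tree.root := by
      rw [he]; exact t.tree.isLink_single_delRoot
    have es : e.tree.attach t.delRoot.forest (fun _ => t.tree.root) hl = t.tree := by
      simp only [he]
      exact t.tree.single_attach_delRoot
    change OTree.attach e t.delRoot (fun _ => t.tree.root) = t
    rw [OTree.attach_of hl]
    refine OTree.ext_of es fun a b h => ?_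
    have ne := not_lt_single he a b
    have hr := @Comparable.right B e.tree t.delRoot.forest _ hl a b h
    have hn : ∀ v, v ∈ t.delRoot.forest.nodes ↔ v ≠ t.tree.root ∧ v ∈ t.tree.nodes := by
      intro v
      exact Finset.mem_erase
    have he' : ∀ v, v ∈ e.tree.nodes ↔ v = t.tree.root := by
      intro v
      rw [he]
      exact Finset.mem_singleton
    have hd : t.delRoot.lt a b ↔ B.Comparable t.delRoot.forest a b ∧ t.lt a b := Iff.rfl
    simp only at h ⊢
    rw [es] at h
    rw [es, hd, he', hn]
    constructor
    · rintro ⟨-, h1 | h1 | h1⟩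
      · exact absurd h1 ne
      · exact h1.2
      · refine t.isOrdering.ancestor h ?_
        rw [h1.1]
        exact root_isAncestor _ h1.2.2 h1.2.1
    · intro hab
      refine ⟨h, Or.inr ?_⟩
      have m := t.isOrdering.mem hab
      by_cases ha : a = t.tree.root
      · refine Or.inr ⟨ha, fun hb => ?_, m.2⟩
        rw [ha, hb] at hab
        exact t.isOrdering.irrefl _ hab
      · by_cases hb : b = t.tree.root
        · exfalso
          have h2 := t.isOrdering.ancestor (a := b) (b := a)
            (let ⟨S, hS, h1, h2⟩ := h; ⟨S, hS, h2, h1⟩) (hb ▸ root_isAncestor _ m.1 ha)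
          obtain ⟨S, hS, h3, h4⟩ := h
          exact t.isOrdering.irrefl _ (t.isOrdering.trans hS h3 h4 h3 hab h2)
        · exact Or.inl ⟨hr ((hn a).2 ⟨ha, m.1⟩) ((hn b).2 ⟨hb, m.2⟩), hab⟩
  attach_empty := by
    intro (t : B.OTree) (V : B.OForest) d (h : V.forest = _)
    have hl : t.tree.IsLink V.forest d := by rw [h]; exact t.tree.isLink_empty d
    have es : t.tree.attach V.forest d hl = t.tree := by
      simp only [h]
      exact t.tree.attach_empty d
    change OTree.attach t V d = t
    rw [OTree.attach_of hl]
    refine OTree.ext_of es fun a b hc => ?_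
    have ne := not_lt_empty h a b
    have nb : b ∉ V.forest.nodes := by
      rw [h]
      exact Finset.notMem_empty b
    simp only at hc ⊢
    tauto
  delRoot_attach_single := by
    intro (U : B.OForest) (e : B.OTree) r (he : e.tree = _) (hr : r ∉ U.forest.nodes)
    have hl : e.tree.IsLink U.forest fun _ => r := by rw [he]; exact RTree.isLink_single hr
    have es : (e.tree.attach U.forest (fun _ => r) hl).delRoot = U.forest := by
      simp only [he]
      exact RTree.delRoot_single_attach hr
    change OTree.delRoot (OTree.attach e U _) = U
    rw [OTree.attach_of hl]
    refine OForest.ext_of es fun a b hc => ?_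
    have ne := not_lt_single he a b
    have hd := hc.of_delRoot
    simp only [OTree.delRoot] at hc hd ⊢
    have hm : a ∈ e.tree.nodes → a ∉ U.forest.nodes := fun h1 h2 =>
      Finset.disjoint_left.1 hl.1 h1 h2
    have hm' : a ∈ U.forest.nodes := by
      rw [es] at hc
      exact hc.mem.1
    tauto
  attach_attach := by
    intro (t₁ : B.OTree) (t₂ : B.OTree) (t₃ : B.OTree) d e (h12 : Disjoint t₁.tree.nodes t₂.tree.nodes)
      (h13 : Disjoint t₁.tree.nodes t₃.tree.nodes) (h23 : Disjoint t₂.tree.nodes t₃.tree.nodes)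
      hd he
    change t₂.tree.IsLink t₁.delRoot.forest d at hd
    change t₃.tree.IsLink (OTree.delRoot (OTree.attach t₂ t₁.delRoot d)).forest e at he
    exact OTree.attach_attach h12 h13 h23 hd he
  attach_restrict := by
    intro (t : B.OTree) (X : B.OForest) d U (e : B.OTree) hd hU (he : e.tree = _)
    change t.tree.IsLink X.forest d at hd
    change (OTree.delRoot (OTree.attach t X d)).forest.IsSubforest U at hU
    exact OTree.attach_restrict hd hU he

end BlockSystem

namespace RForest

/-- The generations of descendants of a set `S` of nodes: `generation S 0` is `S` itself (the first
generation), and `generation S (i + 1)` is the set of the children of `generation S i`. -/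
def generation (F : RForest) (S : Set ℕ) : ℕ → Set ℕ
  | 0 => S
  | i + 1 => {v | ∃ p ∈ F.generation S i, F.parent v = some p}

/-- The union of the first `n` generations of `S`. -/
def firstGenerations (F : RForest) (S : Set ℕ) (n : ℕ) : Set ℕ :=
  {v | ∃ i < n, v ∈ F.generation S i}

theorem generation_mono {F G : RForest} {S T : Set ℕ}
    (h : ∀ v p, F.parent v = some p → G.parent v = some p) (hST : S ⊆ T) (i : ℕ) :
    F.generation S i ⊆ G.generation T i := by
  induction i with
  | zero => exact hST
  | succ i ih => exact fun v ⟨p, hp, hv⟩ => ⟨p, ih hp, h v p hv⟩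

theorem generation_subset {F : RForest} {S : Set ℕ} (hS : S ⊆ F.nodes) (i : ℕ) :
    F.generation S i ⊆ F.nodes := by
  cases i with
  | zero => exact hS
  | succ i => exact fun v ⟨p, hp, hv⟩ => (F.mem_of_parent hv).1

theorem firstGenerations_subset {F : RForest} {S : Set ℕ} (hS : S ⊆ F.nodes) (n : ℕ) :
    F.firstGenerations S n ⊆ F.nodes :=
  fun _ ⟨i, _, hv⟩ => generation_subset hS i hv

theorem image_generation_smul (σ : Equiv.Perm ℕ) (F : RForest) (S : Set ℕ) (i : ℕ) :
    σ '' F.generation S i = (σ • F).generation (σ '' S) i := by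
  induction i with
  | zero => rfl
  | succ i ih =>
    ext v
    simp only [generation, ← ih, parent_smul, Set.mem_image, Set.mem_ofPred_eq]
    constructor
    · rintro ⟨w, ⟨p, hp, hw⟩, rfl⟩
      exact ⟨σ p, ⟨p, hp, rfl⟩, by simp [hw]⟩
    · rintro ⟨_, ⟨p, hp, rfl⟩, hv⟩
      obtain ⟨q, hq, hqp⟩ := Option.map_eq_some_iff.1 hv
      exact ⟨σ.symm v, ⟨p, hp, by rw [hq, σ.injective hqp]⟩, by simp⟩

theorem image_firstGenerations_smul (σ : Equiv.Perm ℕ) (F : RForest) (S : Set ℕ) (n : ℕ) :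
    σ '' F.firstGenerations S n = (σ • F).firstGenerations (σ '' S) n := by
  ext v
  simp only [firstGenerations, ← image_generation_smul, Set.mem_image, Set.mem_ofPred_eq]
  grind

theorem image_roots_smul (σ : Equiv.Perm ℕ) (F : RForest) :
    σ '' (F.roots : Set ℕ) = ((σ • F).roots : Set ℕ) := by
  rw [Family.roots_smul]
  simp

end RForest

/-- The blocks of ordered trees: the set of roots of the forest, and the set of children of each
node. No block contains a node and one of its descendants. -/
def orderedBlocks : BlockSystem where
  blocks F := {S | S = F.roots ∨ ∃ p ∈ F.nodes, S = {v | F.parent v = some p}}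
  subset_nodes := by
    rintro F S (rfl | ⟨p, -, rfl⟩) v hv
    · exact (RForest.mem_roots.1 hv).1
    · exact (F.mem_of_parent hv).1
  smul := by
    rintro σ F S (rfl | ⟨p, hp, rfl⟩)
    · exact Or.inl (RForest.image_roots_smul σ F)
    · refine Or.inr ⟨σ p, by simpa [RForest.nodes_smul] using hp, ?_⟩
      ext v
      rw [Equiv.image_eq_preimage_symm]
      simp [RForest.parent_smul]
  delRoot := by
    rintro t S (rfl | ⟨p, hp, rfl⟩)
    · exact ⟨_, Or.inr ⟨t.root, t.root_mem, rfl⟩, fun v hv => RTree.mem_roots_delRoot.1 hv⟩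
    · refine ⟨_, Or.inr ⟨p, Finset.mem_of_mem_erase hp, rfl⟩, fun v hv => ?_⟩
      simp only [Set.mem_ofPred_eq, RTree.parent_delRoot] at hv ⊢
      grind
  restrict := by
    rintro F U hU S (rfl | ⟨p, hp, rfl⟩)
    · refine ⟨_, Or.inl rfl, fun v hv => ?_⟩
      have := hU.1
      simp only [Finset.mem_coe, RForest.mem_roots, RForest.restrict] at hv ⊢
      grind
    · refine ⟨_, Or.inr ⟨p, hU.1 hp, rfl⟩, fun v hv => ?_⟩
      simp only [Set.mem_ofPred_eq, RForest.restrict] at hv ⊢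
      grind
  attach_left := by
    rintro t U d h S (rfl | ⟨p, hp, rfl⟩)
    · refine ⟨_, Or.inl rfl, fun v hv => ?_⟩
      obtain ⟨hv1, hv2⟩ := hv
      simp only [Finset.mem_coe, RForest.mem_roots, RTree.parent_attach] at hv1 hv2 ⊢
      grind
    · by_cases hpt : p ∈ t.nodes
      · refine ⟨_, Or.inr ⟨p, hpt, rfl⟩, fun v hv => ?_⟩
        obtain ⟨hv1, hv2⟩ := hv
        simp only [Finset.mem_coe, Set.mem_ofPred_eq, RTree.parent_attach] at hv1 hv2 ⊢
        grind
      · refine ⟨_, Or.inl rfl, fun v hv => ?_⟩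
        obtain ⟨hv1, hv2⟩ := hv
        have := @t.mem_of_parent v p
        simp only [Finset.mem_coe, Set.mem_ofPred_eq, RTree.parent_attach] at hv1 hv2 ⊢
        grind
  attach_right := by
    rintro t U d h S (rfl | ⟨p, hp, rfl⟩)
    · refine ⟨_, Or.inl rfl, fun v hv => ?_⟩
      obtain ⟨hv1, hv2⟩ := hv
      rw [(t.attach U d h).roots_eq] at hv1
      have h1 := Finset.mem_singleton.1 hv1
      rw [RTree.root_attach] at h1
      exact absurd hv2 (h1 ▸ Finset.disjoint_left.1 h.1 t.root_mem)
    · have dis := Finset.disjoint_left.1 h.1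
      by_cases hpU : p ∈ U.nodes
      · refine ⟨_, Or.inr ⟨p, hpU, rfl⟩, fun v hv => ?_⟩
        obtain ⟨hv1, hv2⟩ := hv
        have := h.2 v
        have := @dis v
        have := @dis p
        simp only [Finset.mem_coe, Set.mem_ofPred_eq, RTree.parent_attach] at hv1 hv2 ⊢
        grind
      · refine ⟨_, Or.inl rfl, fun v hv => ?_⟩
        obtain ⟨hv1, hv2⟩ := hv
        have := @U.mem_of_parent v p
        have := @dis v
        simp only [Finset.mem_coe, Set.mem_ofPred_eq, RTree.parent_attach] at hv1 hv2 ⊢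
        grind

/-- The only block of a heap-ordered forest is the set of all its nodes. -/
def heapBlocks : BlockSystem where
  blocks F := {(F.nodes : Set ℕ)}
  subset_nodes := by
    rintro F S rfl
    exact subset_rfl
  smul := by
    rintro σ F S rfl
    simp [RForest.nodes_smul]
  delRoot := by
    rintro t S rfl
    exact ⟨_, rfl, Finset.coe_subset.2 (Finset.erase_subset _ _)⟩
  restrict := by
    rintro F U hU S rfl
    exact ⟨_, rfl, Finset.coe_subset.2 hU.1⟩
  attach_left := by
    rintro t U d h S rfl
    exact ⟨_, rfl, Set.inter_subset_right⟩
  attach_right := by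
    rintro t U d h S rfl
    exact ⟨_, rfl, Set.inter_subset_right⟩

theorem generation_attach_inter {t : RTree} {U : RForest} {d : ℕ → ℕ} (h : t.IsLink U d)
    (S : Set ℕ) (i : ℕ) {v : ℕ} (hv : v ∈ (t.attach U d h).generation S i) (hvt : v ∈ t.nodes) :
    v ∈ t.generation (S ∩ t.nodes) i := by
  induction i generalizing v with
  | zero => exact ⟨hv, hvt⟩
  | succ i ih =>
    obtain ⟨p, hp, hpv⟩ := hv
    rw [RTree.parent_attach, if_pos hvt] at hpv
    exact ⟨p, ih hp (t.mem_of_parent hpv).2, hpv⟩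

theorem generation_attach_right {t : RTree} {U : RForest} {d : ℕ → ℕ} (h : t.IsLink U d)
    {S : Set ℕ} (hS : S ⊆ U.nodes) (i : ℕ) :
    (t.attach U d h).generation S i ⊆ U.generation S i := by
  have dis := Finset.disjoint_left.1 h.1
  induction i with
  | zero => exact subset_rfl
  | succ i ih =>
    rintro v ⟨p, hp, hpv⟩
    have hpU : p ∈ U.nodes := RForest.generation_subset hS i (ih hp)
    refine ⟨p, ih hp, ?_⟩
    have := h.2 v
    have := @dis p
    have := @t.mem_of_parent v p
    rw [RTree.parent_attach] at hpv
    grind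

theorem generation_attach_left {t : RTree} {U : RForest} {d : ℕ → ℕ} (h : t.IsLink U d)
    {S : Set ℕ} (hS : S ⊆ t.nodes) (i : ℕ) {v : ℕ} (hv : v ∈ (t.attach U d h).generation S i)
    (hvU : v ∈ U.nodes) : ∃ j < i, v ∈ U.generation U.roots j := by
  have dis := Finset.disjoint_left.1 h.1
  induction i generalizing v with
  | zero => exact absurd hvU (dis (hS hv))
  | succ i ih =>
    obtain ⟨p, hp, hpv⟩ := hv
    rw [RTree.parent_attach, if_neg (fun hvt => dis hvt hvU)] at hpv
    by_cases hr : v ∈ U.roots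
    · exact ⟨0, Nat.succ_pos i, hr⟩
    · rw [if_neg hr] at hpv
      obtain ⟨j, hj, hpj⟩ := ih hp (U.mem_of_parent hpv).2
      exact ⟨j + 1, Nat.succ_lt_succ hj, p, hpj, hpv⟩

/-- The blocks of `n`-generation ordered trees: the first `n` generations of each node `α`, and the
first `n - 1` generations of the roots. -/
def generationBlocks (n : ℕ) : BlockSystem where
  blocks F := {S | (∃ α ∈ F.nodes, S = F.firstGenerations {α} n) ∨
    S = F.firstGenerations F.roots (n - 1)}
  subset_nodes := by
    rintro F S (⟨α, hα, rfl⟩ | rfl)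
    · exact RForest.firstGenerations_subset (by simpa using hα) n
    · exact RForest.firstGenerations_subset (fun v hv => (RForest.mem_roots.1 hv).1) _
  smul := by
    rintro σ F S (⟨α, hα, rfl⟩ | rfl)
    · refine Or.inl ⟨σ α, by simpa [RForest.nodes_smul] using hα, ?_⟩
      rw [RForest.image_firstGenerations_smul, Set.image_singleton]
    · refine Or.inr ?_
      rw [RForest.image_firstGenerations_smul, RForest.image_roots_smul]
  delRoot := by
    have hp : ∀ (t : RTree) (v p : ℕ), t.delRoot.parent v = some p → t.parent v = some p := by
      intro t v p h
      rw [RTree.parent_delRoot] at h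
      grind
    rintro t S (⟨α, hα, rfl⟩ | rfl)
    · refine ⟨_, Or.inl ⟨α, Finset.mem_of_mem_erase hα, rfl⟩, ?_⟩
      rintro v ⟨i, hi, hv⟩
      exact ⟨i, hi, RForest.generation_mono (hp t) subset_rfl i hv⟩
    · refine ⟨_, Or.inl ⟨t.root, t.root_mem, rfl⟩, ?_⟩
      rintro v ⟨i, hi, hv⟩
      refine ⟨i + 1, by omega, ?_⟩
      clear hi
      induction i generalizing v with
      | zero => exact ⟨t.root, rfl, RTree.mem_roots_delRoot.1 hv⟩
      | succ i ih =>
        obtain ⟨p, hpi, hpv⟩ := hv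
        exact ⟨p, ih hpi, hp t v p hpv⟩
  restrict := by
    have hp : ∀ (F : RForest) (U : Finset ℕ) (hU : F.IsSubforest U) (v p : ℕ),
        (F.restrict U hU).parent v = some p → F.parent v = some p := by
      intro F U hU v p h
      simp only [RForest.restrict] at h
      grind
    rintro F U hU S (⟨α, hα, rfl⟩ | rfl)
    · refine ⟨_, Or.inl ⟨α, hU.1 hα, rfl⟩, ?_⟩
      rintro v ⟨i, hi, hv⟩
      exact ⟨i, hi, RForest.generation_mono (hp F U hU) subset_rfl i hv⟩
    · refine ⟨_, Or.inr rfl, ?_⟩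
      rintro v ⟨i, hi, hv⟩
      refine ⟨i, hi, RForest.generation_mono (hp F U hU) (fun w hw => ?_) i hv⟩
      have := hU.1
      simp only [Finset.mem_coe, RForest.mem_roots, RForest.restrict] at hw ⊢
      grind
  attach_left := by
    rintro t U d h S (⟨α, hα, rfl⟩ | rfl)
    · by_cases hαt : α ∈ t.nodes
      · refine ⟨_, Or.inl ⟨α, hαt, rfl⟩, ?_⟩
        rintro v ⟨⟨i, hi, hv⟩, hvt⟩
        exact ⟨i, hi, RForest.generation_mono (fun _ _ h => h) Set.inter_subset_left i
          (generation_attach_inter h _ i hv hvt)⟩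
      · refine ⟨_, Or.inr rfl, ?_⟩
        rintro v ⟨⟨i, hi, hv⟩, hvt⟩
        have hαU : α ∈ U.nodes := (Finset.mem_union.1 hα).resolve_left hαt
        have := RForest.generation_subset (S := {α}) (by simpa using hαU) i
          (generation_attach_right h (by simpa using hαU) i hv)
        exact absurd this (Finset.disjoint_left.1 h.1 hvt)
    · refine ⟨_, Or.inr rfl, ?_⟩
      rintro v ⟨⟨i, hi, hv⟩, hvt⟩
      refine ⟨i, hi, RForest.generation_mono (fun _ _ h => h) ?_ i
        (generation_attach_inter h _ i hv hvt)⟩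
      rw [(t.attach U d h).roots_eq, t.roots_eq]
      exact Set.inter_subset_left
  attach_right := by
    rintro t U d h S (⟨α, hα, rfl⟩ | rfl)
    · by_cases hαt : α ∈ t.nodes
      · refine ⟨_, Or.inr rfl, ?_⟩
        rintro v ⟨⟨i, hi, hv⟩, hvU⟩
        obtain ⟨j, hj, hvj⟩ := generation_attach_left h (by simpa using hαt) i hv hvU
        exact ⟨j, by omega, hvj⟩
      · have hαU : α ∈ U.nodes := (Finset.mem_union.1 hα).resolve_left hαt
        refine ⟨_, Or.inl ⟨α, hαU, rfl⟩, ?_⟩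
        rintro v ⟨⟨i, hi, hv⟩, -⟩
        exact ⟨i, hi, generation_attach_right h (by simpa using hαU) i hv⟩
    · refine ⟨_, Or.inr rfl, ?_⟩
      rintro v ⟨⟨i, hi, hv⟩, hvU⟩
      rw [(t.attach U d h).roots_eq, RTree.root_attach] at hv
      obtain ⟨j, hj, hvj⟩ := generation_attach_left h (by simpa using t.root_mem) i hv hvU
      exact ⟨j, by omega, hvj⟩

/-- The family of ordered trees. -/
noncomputable def orderedTrees : Family := orderedBlocks.family
/-- The family of heap-ordered trees. -/
noncomputable def heapOrderedTrees : Family := heapBlocks.family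
/-- The family of `n`-generation ordered trees. -/
noncomputable def generationOrderedTrees (n : ℕ) : Family := (generationBlocks n).family

end RootedTrees

/-!
The isomorphism classes of trees form a monoid under `⊙` with unit `e`, and the number of children
of the root (`rootDegree`) is additive and vanishes only at `e`. Hence every tree is a `⊙`-product
of indecomposable trees, and unique decomposition says that the trees are the free monoid on the
indecomposable ones.

In the product `t₁ · t₂` the link map that is constant with value the root of `t₂` gives `t₁ ⊙ t₂`,
and every other link map gives a tree whose root has fewer children. So the product of a word of
indecomposable trees in the tree algebra is their `⊙`-product plus trees of smaller root degree
(`prod_treeBasis_sub_odotProd_mem`). The homomorphism from the free algebra is therefore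
unitriangular with respect to the basis of words and the basis of trees, which correspond
bijectively under `⊙`; such a map is bijective (`bijective_of_unitriangular`).

Unique decomposition follows by Levi's lemma once any two factorizations `a ⊙ b = c ⊙ d` have a
common refinement (`uniqueDecomposition_of_equidivisible`). Take both products to be the same tree
`T`, and regard `delRoot b` and `delRoot d` as subforests of `delRoot T`. If one of them contains the
other, the trees in the difference form the middle factor, by the compatibility of attachment with
restriction (`exists_middle_factor`). For trees with ordered blocks in which the children of the
root are comparable, the trees of `delRoot b` precede all other trees of `delRoot T`, and so do those
of `delRoot d`; as two initial segments of a total order they are nested. This covers ordered,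
heap-ordered, and `n`-generation ordered trees with `n ≥ 2`, where the children of the root belong
to the first two generations of the root.
-/

namespace RootedTrees

open scoped Classical

/-! ### Elementary facts on rooted trees -/

namespace RTree

theorem smul_single (σ : Equiv.Perm ℕ) (r : ℕ) : σ • single r = single (σ r) := by
  refine ext' ?_
  ext1
  · simp [toRForest_smul, RForest.nodes_smul, single]
  · funext v
    simp [toRForest_smul, RForest.parent_smul, single]

/-- A tree whose root has no children consists of its root. -/
theorem eq_single_of_roots_delRoot {t : RTree} (h : t.delRoot.roots = ∅) :
    t = single t.root := by
  have hn : t.nodes = {t.root} := by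
    refine Finset.eq_singleton_iff_unique_mem.2 ⟨t.root_mem, fun v hv => ?_⟩
    by_contra hne
    obtain ⟨w, hw, -⟩ := Relation.TransGen.head'_iff.1 (BlockSystem.root_isAncestor t hv hne)
    have := mem_roots_delRoot.2 hw
    simp [h] at this
  refine ext' ?_
  ext1
  · exact hn
  · funext v
    by_cases hv : v ∈ t.nodes
    · rw [hn, Finset.mem_singleton] at hv
      rw [hv]
      exact t.parent_root
    · exact RForest.parent_eq_none_of_notMem hv

/-- If a forest is attached at the root of `t`, its nodes form a subforest of the new tree without
its root. -/
theorem IsLink.isSubforest_right {t : RTree} {U : RForest} (h : t.IsLink U fun _ => t.root) :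
    (t.attach U _ h).delRoot.IsSubforest U.nodes := by
  have dis := Finset.disjoint_left.1 h.1
  have hr := dis t.root_mem
  refine ⟨fun v hv => ?_, fun v p hp => ?_⟩
  · rw [nodes_delRoot, nodes_attach, root_attach, Finset.mem_erase, Finset.mem_union]
    exact ⟨fun e => hr (e ▸ hv), Or.inr hv⟩
  · rw [parent_delRoot, root_attach, parent_attach] at hp
    have h1 := @t.mem_of_parent v p
    have h2 := @U.mem_of_parent v p
    have h3 := @dis v
    have h4 := @dis p
    grind

theorem IsLink.isSubforest_left {t : RTree} {U : RForest} (h : t.IsLink U fun _ => t.root) :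
    (t.attach U _ h).delRoot.IsSubforest t.delRoot.nodes := by
  have dis := Finset.disjoint_left.1 h.1
  refine ⟨?_, fun v p hp => ?_⟩
  · rw [nodes_delRoot, nodes_delRoot, nodes_attach, root_attach]
    exact Finset.erase_subset_erase _ Finset.subset_union_left
  · rw [parent_delRoot, root_attach, parent_attach] at hp
    have h1 := @t.mem_of_parent v p
    have h2 := @U.mem_of_parent v p
    have h3 := @dis v
    have h4 := @dis p
    have h5 := t.parent_root
    simp only [nodes_delRoot, Finset.mem_erase]
    grind

end RTree

theorem RForest.IsSubforest.inter {F : RForest} {S T : Finset ℕ} (hS : F.IsSubforest S)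
    (hT : F.IsSubforest T) : F.IsSubforest (S ∩ T) :=
  ⟨Finset.inter_subset_left.trans hS.1, fun v p h => by
    rw [Finset.mem_inter, Finset.mem_inter, hS.2 v p h, hT.2 v p h]⟩

/-- Two subforests of a forest are nested unless each of them contains a tree that the other does
not contain. -/
theorem RForest.IsSubforest.exists_root {F : RForest} {S T : Finset ℕ} (hS : F.IsSubforest S)
    (hT : F.IsSubforest T) (h : ¬ S ⊆ T) : ∃ r ∈ F.roots, r ∈ S ∧ r ∉ T := by
  obtain ⟨v, hvS, hvT⟩ := Finset.not_subset.1 h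
  clear h
  induction v using F.wf.induction with
  | _ v ih =>
    by_cases hv : F.parent v = none
    · exact ⟨v, RForest.mem_roots.2 ⟨hS.1 hvS, hv⟩, hvS, hvT⟩
    · obtain ⟨p, hp⟩ := Option.ne_none_iff_exists'.1 hv
      exact ih p hp ((hS.2 v p hp).1 hvS) (fun h => hvT ((hT.2 v p hp).2 h))

namespace Family
variable {X : Family.{u}}

/-! ### The monoid of trees under `⊙` -/

theorem isLink_root {t : X.Tree} {U : X.Forest}
    (h : Disjoint (X.under t).nodes (X.underF U).nodes) :
    (X.under t).IsLink (X.underF U) fun _ => (X.under t).root :=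
  ⟨h, fun _ _ => (X.under t).root_mem⟩

theorem isLink_of_single {e : X.Tree} {U : X.Forest} {r : ℕ} (he : X.under e = RTree.single r)
    (hr : r ∉ (X.underF U).nodes) : (X.under e).IsLink (X.underF U) fun _ => r := by
  rw [he]
  exact RTree.isLink_single hr

theorem exists_plant (U : X.Forest) : ∃ p : X.Tree × ℕ, X.under p.1 = RTree.single p.2 ∧
    p.2 ∉ (X.underF U).nodes := by
  obtain ⟨e, r, hr, he, -⟩ := X.exists_single_rep (X.underF U).nodes
  exact ⟨(e, r), he, hr⟩

/-- The class of the tree `e ↼ U` formed by joining all trees of the forest `U` to a new root; by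
`plant_eq` the name of the new root does not matter. -/
noncomputable def plant (U : X.Forest) : X.Cls :=
  cls (X.attach (exists_plant U).choose.1 U fun _ => (exists_plant U).choose.2)

theorem plant_eq {U : X.Forest} {e : X.Tree} {r : ℕ} (he : X.under e = RTree.single r)
    (hr : r ∉ (X.underF U).nodes) : plant U = cls (X.attach e U fun _ => r) := by
  have hp := (exists_plant U).choose_spec
  unfold plant
  generalize (exists_plant U).choose = p at hp ⊢
  obtain ⟨e', r'⟩ := p
  obtain ⟨he', hr'⟩ := hp
  have hU : Equiv.swap r r' • U = U := by
    refine X.smulF_eq_of_fix _ _ fun v hv => Equiv.swap_apply_of_ne_of_ne ?_ ?_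
    · rintro rfl
      exact hr hv
    · rintro rfl
      exact hr' hv
  have hee : Equiv.swap r r' • e = e' := by
    refine (X.existsUnique_single r').unique ?_ he'
    rw [X.under_smul, he, RTree.smul_single, Equiv.swap_apply_left]
  rw [← cls_smul (Equiv.swap r r') (X.attach e U _),
    ← X.attach_smul _ _ _ _ (isLink_of_single he hr), hU, hee]
  simp only [Equiv.swap_apply_left]

theorem root_notMem_delRoot (t : X.Tree) :
    (X.under t).root ∉ (X.underF (X.delRoot t)).nodes := by
  rw [underF_delRoot_nodes]
  exact Finset.notMem_erase _ _

theorem plant_delRoot (t : X.Tree) : plant (X.delRoot t) = cls t := by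
  obtain ⟨e, he, -⟩ := X.existsUnique_single (X.under t).root
  rw [plant_eq he (root_notMem_delRoot t), X.attach_single_delRoot t e he]

theorem odot_plant {t : X.Tree} {U : X.Forest}
    (h : Disjoint (X.under t).nodes (X.underF U).nodes) :
    odot (plant U) (cls t) = cls (X.attach t U fun _ => (X.under t).root) := by
  obtain ⟨e, r, hr, he, -⟩ := X.exists_single_rep ((X.under t).nodes ∪ (X.underF U).nodes)
  rw [Finset.mem_union, not_or] at hr
  rw [plant_eq he hr.2, odot_eq, X.delRoot_attach_single U e r he hr.2]
  rw [nodes_attach (isLink_of_single he hr.2), he, Finset.disjoint_union_left]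
  exact ⟨by simpa [RTree.single] using hr.1, h.symm⟩

theorem unit_odot (c : X.Cls) : odot X.unit c = c := by
  obtain ⟨t, rfl, -⟩ := X.exists_rep_disjoint c ∅
  obtain ⟨e, r, hr, he, hu⟩ := X.exists_single_rep (X.under t).nodes
  rw [← hu, odot_eq (by rw [he]; simpa [RTree.single] using hr),
    X.attach_empty _ _ _ (under_delRoot_single he)]

theorem odot_unit (c : X.Cls) : odot c X.unit = c := by
  obtain ⟨t, rfl, -⟩ := X.exists_rep_disjoint c ∅
  obtain ⟨e, r, hr, he, hu⟩ := X.exists_single_rep (X.underF (X.delRoot t)).nodes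
  have hd : Disjoint (X.under e).nodes (X.underF (X.delRoot t)).nodes :=
    (isLink_of_single he hr).1
  have h := odot_plant hd
  simp only [he, hu, plant_delRoot] at h
  rw [h]
  exact (plant_eq he hr).symm.trans (plant_delRoot t)

theorem odot_assoc (a b c : X.Cls) : odot (odot a b) c = odot a (odot b c) := by
  obtain ⟨t₃, rfl, -⟩ := X.exists_rep_disjoint c ∅
  obtain ⟨t₂, rfl, h23⟩ := X.exists_rep_disjoint b (X.under t₃).nodes
  obtain ⟨t₁, rfl, h1⟩ := X.exists_rep_disjoint a ((X.under t₂).nodes ∪ (X.under t₃).nodes)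
  rw [Finset.disjoint_union_right] at h1
  have l12 := isLink_root (disjoint_delRoot h1.1.symm)
  have l23 := isLink_root (disjoint_delRoot h23.symm)
  have hT : Disjoint (X.under (X.attach t₂ (X.delRoot t₁) fun _ => (X.under t₂).root)).nodes
      (X.under t₃).nodes := by
    rw [nodes_attach l12, Finset.disjoint_union_left]
    exact ⟨h23, (disjoint_delRoot h1.2.symm).symm⟩
  have hS : Disjoint (X.under t₁).nodes
      (X.under (X.attach t₃ (X.delRoot t₂) fun _ => (X.under t₃).root)).nodes := by
    rw [nodes_attach l23, Finset.disjoint_union_right]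
    exact ⟨h1.2, disjoint_delRoot h1.1⟩
  rw [odot_eq h1.1, odot_eq h23, odot_eq hT, odot_eq hS,
    X.attach_attach t₁ t₂ t₃ _ _ h1.1 h1.2 h23 l12 (isLink_root (disjoint_delRoot hT.symm))]
  simp only [if_true, X.under_attach _ _ _ l23, RTree.root_attach]

/-- The number of children of the root. -/
noncomputable def rootDegree (c : X.Cls) : ℕ :=
  Quotient.liftOn' c (fun t => (X.underF (X.delRoot t)).roots.card) (by
    intro s t h
    obtain ⟨σ, rfl⟩ := cls_eq_cls.1 (Quotient.sound' h)
    simp only [X.delRoot_smul, X.underF_smul, roots_smul, Finset.card_map])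

theorem rootDegree_cls (t : X.Tree) :
    rootDegree (cls t) = (X.underF (X.delRoot t)).roots.card := rfl

theorem rootDegree_attach {t : X.Tree} {U : X.Forest} {d : ℕ → ℕ}
    (h : (X.under t).IsLink (X.underF U) d) :
    rootDegree (cls (X.attach t U d)) = rootDegree (cls t) +
      ((X.underF U).roots.filter fun v => d v = (X.under t).root).card := by
  rw [rootDegree_cls, rootDegree_cls, ← Finset.card_union_of_disjoint]
  · congr 1
    ext v
    rw [mem_roots_delRoot_attach h, Finset.mem_union, Finset.mem_filter]
  · refine Finset.disjoint_left.2 fun v hv hv' => Finset.disjoint_left.1 h.1 ?_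
      (RForest.mem_roots.1 (Finset.mem_filter.1 hv').1).1
    exact ((X.under t).mem_of_parent (mem_roots_delRoot.1 hv)).1

theorem rootDegree_odot (a b : X.Cls) : rootDegree (odot a b) = rootDegree a + rootDegree b := by
  obtain ⟨t₂, rfl, -⟩ := X.exists_rep_disjoint b ∅
  obtain ⟨t₁, rfl, h⟩ := X.exists_rep_disjoint a (X.under t₂).nodes
  rw [odot_eq h, rootDegree_attach (isLink_root (disjoint_delRoot h.symm)), add_comm]
  simp [rootDegree_cls]

theorem rootDegree_eq_zero {c : X.Cls} : rootDegree c = 0 ↔ c = X.unit := by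
  constructor
  · obtain ⟨t, rfl, -⟩ := X.exists_rep_disjoint c ∅
    intro h
    rw [rootDegree_cls, Finset.card_eq_zero, X.underF_delRoot] at h
    exact cls_eq_unit (RTree.eq_single_of_roots_delRoot h)
  · rintro rfl
    have h := rootDegree_odot X.unit X.unit
    rw [unit_odot] at h
    omega

/-- The product `x₁ ⊙ ⋯ ⊙ x_p` of a sequence of indecomposable trees. -/
noncomputable def odotProd (xs : List X.Indecomposables) : X.Cls :=
  (xs.map Subtype.val).foldr odot X.unit

theorem odotProd_nil : odotProd ([] : List X.Indecomposables) = X.unit := rfl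

theorem odotProd_cons (x : X.Indecomposables) (xs : List X.Indecomposables) :
    odotProd (x :: xs) = odot x.1 (odotProd xs) := rfl

theorem odotProd_append (xs ys : List X.Indecomposables) :
    odotProd (xs ++ ys) = odot (odotProd xs) (odotProd ys) := by
  induction xs with
  | nil => exact (unit_odot _).symm
  | cons x xs ih => rw [List.cons_append, odotProd_cons, ih, odotProd_cons, odot_assoc]

theorem odotProd_surjective : Function.Surjective (odotProd (X := X)) := by
  intro c
  induction h : rootDegree c using Nat.strong_induction_on generalizing c with
  | _ n ih =>
    by_cases hc : IsIndecomposable c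
    · exact ⟨[⟨c, hc⟩], odot_unit c⟩
    · by_cases hu : c = X.unit
      · exact ⟨[], hu.symm⟩
      · unfold IsIndecomposable at hc
        push Not at hc
        obtain ⟨c₁, c₂, rfl, h1, h2⟩ := hc hu
        rw [rootDegree_odot] at h
        rw [Ne, ← rootDegree_eq_zero] at h1 h2
        obtain ⟨xs, hx⟩ := ih _ (by omega) c₁ rfl
        obtain ⟨ys, hy⟩ := ih _ (by omega) c₂ rfl
        exact ⟨xs ++ ys, by rw [odotProd_append, hx, hy]⟩

/-- Levi's lemma: if any two factorizations of a tree into two factors have a common refinement,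
then decompositions into indecomposable trees are unique. -/
theorem uniqueDecomposition_of_equidivisible
    (h : ∀ a b c d : X.Cls, odot a b = odot c d →
      ∃ m, (a = odot c m ∧ d = odot m b) ∨ (c = odot a m ∧ b = odot m d)) :
    X.UniqueDecomposition := by
  have key : ∀ (x : X.Indecomposables) (xs : List X.Indecomposables),
      odotProd (x :: xs) ≠ X.unit := by
    intro x xs he
    rw [odotProd_cons, ← rootDegree_eq_zero, rootDegree_odot] at he
    exact x.2.1 (rootDegree_eq_zero.1 (by omega))
  have left : ∀ {x y : X.Indecomposables} {m : X.Cls}, x.1 = odot y.1 m → m = X.unit :=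
    fun {x y m} hm => (x.2.2 _ _ hm).resolve_left y.2.1
  intro xs
  induction xs with
  | nil =>
    rintro (_ | ⟨y, ys⟩) he
    · rfl
    · exact absurd he.symm (key y ys)
  | cons x xs ih =>
    rintro (_ | ⟨y, ys⟩) he
    · exact absurd he (key x xs)
    · obtain ⟨m, ⟨h1, h2⟩ | ⟨h1, h2⟩⟩ := h x.1 (odotProd xs) y.1 (odotProd ys) he
      · obtain rfl := left h1
        rw [odot_unit] at h1
        rw [unit_odot] at h2
        rw [Subtype.ext h1, ih ys h2.symm]
      · obtain rfl := left h1
        rw [odot_unit] at h1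
        rw [unit_odot] at h2
        rw [Subtype.ext h1, ih ys h2]

/-! ### Common refinements of two factorizations -/

theorem restrict_delRoot_attach_right {t : X.Tree} {U : X.Forest}
    (h : Disjoint (X.under t).nodes (X.underF U).nodes) :
    X.restrict (X.delRoot (X.attach t U fun _ => (X.under t).root)) (X.underF U).nodes = U := by
  have hl := isLink_root h
  have hr := Finset.disjoint_left.1 h (X.under t).root_mem
  obtain ⟨e, he, -⟩ := X.existsUnique_single (X.under t).root
  have hs : (X.underF (X.delRoot (X.attach t U fun _ => (X.under t).root))).IsSubforest
      (X.underF U).nodes := by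
    rw [X.underF_delRoot, X.under_attach _ _ _ hl]
    exact hl.isSubforest_right
  have hs' : (X.underF (X.delRoot t)).IsSubforest ∅ := ⟨Finset.empty_subset _, by simp⟩
  have hE : X.underF (X.restrict (X.delRoot t) ∅) = RForest.empty := by
    rw [X.underF_restrict _ _ hs']
    ext1
    · rfl
    · funext v
      simp [RForest.restrict, RForest.empty]
  have hq := X.attach_restrict t U _ _ e hl hs he
  rw [Finset.inter_comm, Finset.disjoint_iff_inter_eq_empty.1 h, Finset.inter_self,
    X.restrict_self, X.attach_empty _ _ _ hE] at hq
  refine (X.delRoot_attach_single _ e _ he ?_).symm.trans ?_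
  · rw [X.underF_restrict _ _ hs]
    exact hr
  · rw [hq, X.delRoot_attach_single _ e _ he hr]

theorem restrict_delRoot_attach_left {t : X.Tree} {U : X.Forest}
    (h : Disjoint (X.under t).nodes (X.underF U).nodes) :
    X.restrict (X.delRoot (X.attach t U fun _ => (X.under t).root))
      (X.underF (X.delRoot t)).nodes = X.delRoot t := by
  have hl := isLink_root h
  obtain ⟨e, he, -⟩ := X.existsUnique_single (X.under t).root
  have hs : (X.underF (X.delRoot (X.attach t U fun _ => (X.under t).root))).IsSubforest
      (X.underF (X.delRoot t)).nodes := by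
    rw [X.underF_delRoot, X.underF_delRoot, X.under_attach _ _ _ hl]
    exact hl.isSubforest_left
  have hs' : (X.underF U).IsSubforest ∅ := ⟨Finset.empty_subset _, by simp⟩
  have hE : X.underF (X.restrict U ∅) = RForest.empty := by
    rw [X.underF_restrict _ _ hs']
    ext1
    · rfl
    · funext v
      simp [RForest.restrict, RForest.empty]
  have hsub : (X.underF (X.delRoot t)).nodes ⊆ (X.under t).nodes := by
    rw [underF_delRoot_nodes]
    exact Finset.erase_subset _ _
  have hq := X.attach_restrict t U _ _ e hl hs he
  rw [Finset.inter_eq_left.2 hsub,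
    Finset.disjoint_iff_inter_eq_empty.1 (h.mono_left hsub), X.restrict_self,
    X.attach_empty _ _ _ hE] at hq
  refine (X.delRoot_attach_single _ e _ he ?_).symm.trans ?_
  · rw [X.underF_restrict _ _ hs]
    exact root_notMem_delRoot t
  · rw [hq, X.delRoot_attach_single _ e _ he (root_notMem_delRoot t)]

/-- If one tree arises in two ways by attaching a forest at the root, and the nodes of `b` are
among those of `d`, then the trees of `V` that lie in `d` form a middle factor. -/
theorem exists_middle_factor {b d : X.Tree} {V Y : X.Forest}
    (hb : Disjoint (X.under b).nodes (X.underF V).nodes)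
    (hd : Disjoint (X.under d).nodes (X.underF Y).nodes)
    (h : X.attach b V (fun _ => (X.under b).root) = X.attach d Y fun _ => (X.under d).root)
    (hbd : (X.underF (X.delRoot b)).nodes ⊆ (X.underF (X.delRoot d)).nodes) :
    ∃ m, plant V = odot (plant Y) m ∧ cls d = odot m (cls b) := by
  have lb := isLink_root hb
  have ld := isLink_root hd
  have hroot : (X.under b).root = (X.under d).root := by
    have h1 := congrArg (fun t => (X.under t).root) h
    simpa only [X.under_attach _ _ _ lb, X.under_attach _ _ _ ld, RTree.root_attach] using h1
  have hnodes : (X.under b).nodes ∪ (X.underF V).nodes =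
      (X.under d).nodes ∪ (X.underF Y).nodes := by
    rw [← nodes_attach lb, ← nodes_attach ld, h]
  have rb := restrict_delRoot_attach_right hb
  have rd := restrict_delRoot_attach_left hd
  obtain ⟨e, he, -⟩ := X.existsUnique_single (X.under b).root
  have he' := he
  rw [hroot] at he'
  set T := X.attach b V fun _ => (X.under b).root with hT
  rw [← h] at rd
  have sV : (X.underF (X.delRoot T)).IsSubforest (X.underF V).nodes := by
    rw [X.underF_delRoot, hT, X.under_attach _ _ _ lb]
    exact lb.isSubforest_right
  have sd : (X.underF (X.delRoot T)).IsSubforest (X.underF (X.delRoot d)).nodes := by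
    rw [X.underF_delRoot, h, X.under_attach _ _ _ ld, X.underF_delRoot]
    exact ld.isSubforest_left
  have sM := sV.inter sd
  -- the middle factor consists of the trees of `V` that lie in `d`
  set M := (X.underF V).nodes ∩ (X.underF (X.delRoot d)).nodes with hM
  set R := X.restrict (X.delRoot T) M with hR
  have nR : (X.underF R).nodes = M := by
    rw [hR, X.underF_restrict _ _ sM]
    rfl
  have RV : X.restrict V M = R := by
    conv_lhs => rw [← rb]
    exact (X.restrict_restrict _ _ _ sM sV Finset.inter_subset_left).symm
  have Rd : X.restrict (X.delRoot d) M = R := by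
    conv_lhs => rw [← rd]
    exact (X.restrict_restrict _ _ _ sM sd Finset.inter_subset_right).symm
  have nb := underF_delRoot_nodes b
  have nd := underF_delRoot_nodes d
  have dis := Finset.disjoint_left.1 hb
  have disd := Finset.disjoint_left.1 hd
  have memb := (X.under b).root_mem
  have memd := (X.under d).root_mem
  have hbn : (X.under b).nodes ⊆ (X.under d).nodes := by
    intro v hv
    have := @hbd v
    grind
  refine ⟨plant R, ?_, ?_⟩
  · have sV' : (X.underF (X.delRoot (X.attach d Y fun _ => (X.under d).root))).IsSubforest
        (X.underF V).nodes := h ▸ sV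
    -- restrict `d ↼ Y` to `V`, which contains `Y` and meets `d` in the middle factor
    have hq := X.attach_restrict d Y _ _ e ld sV' he'
    have e1 : (X.underF V).nodes ∩ (X.underF Y).nodes = (X.underF Y).nodes := by
      refine Finset.inter_eq_right.2 fun v hv => ?_
      have h1 : v ∈ (X.under b).nodes ∪ (X.underF V).nodes := by
        rw [hnodes]
        exact Finset.mem_union_right _ hv
      refine (Finset.mem_union.1 h1).resolve_left fun h2 => disd (hbn h2) hv
    have e2 : (X.underF V).nodes ∩ (X.under d).nodes = M := by
      ext v
      have := @dis v
      simp only [hM, nd, Finset.mem_inter, Finset.mem_erase]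
      grind
    rw [← h, rb, e1, e2, X.restrict_self, Rd] at hq
    have hrV : (X.under d).root ∉ (X.underF V).nodes := hroot ▸ dis memb
    have hrR : (X.under d).root ∉ (X.underF R).nodes := by
      rw [nR]
      exact fun h1 => hrV (Finset.mem_inter.1 h1).1
    have lR := isLink_of_single he' hrR
    have hrt : (X.under (X.attach e R fun _ => (X.under d).root)).root = (X.under d).root := by
      rw [X.under_attach _ _ _ lR, RTree.root_attach, he']
      rfl
    have hdis : Disjoint (X.under (X.attach e R fun _ => (X.under d).root)).nodes
        (X.underF Y).nodes := by
      rw [nodes_attach lR, he', nR]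
      refine hd.mono_left (Finset.union_subset ?_ ?_)
      · simpa [RTree.single] using memd
      · rw [← e2]
        exact Finset.inter_subset_right
    rw [plant_eq he' hrV, hq, plant_eq he' hrR, odot_plant hdis, hrt]
  · -- restrict `b ↼ V` to `d`, which contains `b` and meets `V` in the middle factor
    have hq := X.attach_restrict b V _ _ e lb sd he
    have e1 : (X.underF (X.delRoot d)).nodes ∩ (X.under b).nodes =
        (X.underF (X.delRoot b)).nodes := by
      ext v
      have := @hbd v
      simp only [Finset.mem_inter]
      grind
    rw [← hT, rd, e1, X.restrict_self, X.attach_single_delRoot b e he, Finset.inter_comm, ← hM, RV,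
      hroot, X.attach_single_delRoot d e he', ← hroot] at hq
    conv_lhs => rw [hq]
    refine (odot_plant ?_).symm
    rw [nR]
    exact hb.mono_right Finset.inter_subset_left

/-- Trees have common refinements of factorizations as soon as the forests `delRoot b` and
`delRoot d` are nested whenever `b` and `d` are right factors of the same tree. -/
theorem uniqueDecomposition_of_nested
    (H : ∀ (b d : X.Tree) (V Y : X.Forest),
      Disjoint (X.under b).nodes (X.underF V).nodes →
      Disjoint (X.under d).nodes (X.underF Y).nodes →
      X.attach b V (fun _ => (X.under b).root) = X.attach d Y (fun _ => (X.under d).root) →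
      (X.underF (X.delRoot b)).nodes ⊆ (X.underF (X.delRoot d)).nodes ∨
        (X.underF (X.delRoot d)).nodes ⊆ (X.underF (X.delRoot b)).nodes) :
    X.UniqueDecomposition := by
  refine uniqueDecomposition_of_equidivisible fun a' b' c' d' h => ?_
  obtain ⟨b, rfl, -⟩ := X.exists_rep_disjoint b' ∅
  obtain ⟨a, rfl, hab⟩ := X.exists_rep_disjoint a' (X.under b).nodes
  obtain ⟨d, rfl, -⟩ := X.exists_rep_disjoint d' ∅
  obtain ⟨c, rfl, hcd⟩ := X.exists_rep_disjoint c' (X.under d).nodes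
  have l₁ := isLink_root (disjoint_delRoot hcd.symm)
  rw [odot_eq hab, odot_eq hcd] at h
  obtain ⟨σ, hσ⟩ := cls_eq_cls.1 h
  rw [← X.attach_smul _ _ _ _ l₁, ← X.delRoot_smul] at hσ
  have hroot : σ (X.under d).root = (X.under (σ • d)).root := by
    rw [X.under_smul, RTree.root_smul]
  rw [hroot] at hσ
  have hcd' : Disjoint (X.under (σ • c)).nodes (X.under (σ • d)).nodes := by
    rw [nodes_smul, nodes_smul, Finset.disjoint_map]
    exact hcd
  rw [← cls_smul σ c, ← cls_smul σ d, ← plant_delRoot a, ← plant_delRoot (σ • c)]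
  have h1 := disjoint_delRoot hab.symm
  have h2 := disjoint_delRoot hcd'.symm
  rcases H _ _ _ _ h1 h2 hσ.symm with hs | hs
  · obtain ⟨m, hm⟩ := exists_middle_factor h1 h2 hσ.symm hs
    exact ⟨m, Or.inl hm⟩
  · obtain ⟨m, hm⟩ := exists_middle_factor h2 h1 hσ hs
    exact ⟨m, Or.inr hm⟩

end Family

/-! ### Trees with ordered blocks -/

namespace BlockSystem
variable {B : BlockSystem}

/-- If the children of the root lie in one block, then the trees of the right factor `b` of a
product `a ⊙ b` form an initial segment of the totally ordered set of children of the
root, and initial segments are nested. -/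
theorem uniqueDecomposition
    (H : ∀ t : RTree, ∃ S ∈ B.blocks t.toRForest, ∀ v ∈ t.delRoot.roots, v ∈ S) :
    B.family.UniqueDecomposition := by
  refine Family.uniqueDecomposition_of_nested ?_
  intro (b : B.OTree) (d : B.OTree) (V : B.OForest) (Y : B.OForest)
    (hb : Disjoint b.tree.nodes V.forest.nodes) (hd : Disjoint d.tree.nodes Y.forest.nodes)
    (h : b.attach V (fun _ => b.tree.root) = d.attach Y fun _ => d.tree.root)
  change b.tree.delRoot.nodes ⊆ d.tree.delRoot.nodes ∨ d.tree.delRoot.nodes ⊆ b.tree.delRoot.nodes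
  by_contra hne
  push Not at hne
  have lb : b.tree.IsLink V.forest fun _ => b.tree.root := ⟨hb, fun _ _ => b.tree.root_mem⟩
  have ld : d.tree.IsLink Y.forest fun _ => d.tree.root := ⟨hd, fun _ _ => d.tree.root_mem⟩
  have sb := lb.isSubforest_left
  have sd := ld.isSubforest_left
  have hlt := OTree.lt_attach lb
  have hlt' := OTree.lt_attach ld
  have mb := OTree.mem_attach lb
  have md := OTree.mem_attach ld
  have rootb := OTree.root_attach lb
  have rootd := OTree.root_attach ld
  rw [← OTree.tree_attach lb] at sb
  rw [← OTree.tree_attach ld] at sd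
  rw [← h] at sd hlt' md rootd
  set T := b.attach V fun _ => b.tree.root with hT
  obtain ⟨x, hx, hxb, hxd⟩ := sb.exists_root sd hne.1
  obtain ⟨y, hy, hyd, hyb⟩ := sd.exists_root sb hne.2
  obtain ⟨S, hS, hSr⟩ := H T.tree
  have hxT := Finset.mem_erase.1 (RForest.mem_roots.1 hx).1
  have hyT := Finset.mem_erase.1 (RForest.mem_roots.1 hy).1
  rw [RTree.nodes_delRoot, Finset.mem_erase] at hxb hxd hyb hyd
  have hyV : y ∈ V.forest.nodes := by
    have := (mb y).1 hyT.2
    grind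
  have hxY : x ∈ Y.forest.nodes := by
    have := (md x).1 hxT.2
    grind
  have sx := hSr x hx
  have sy := hSr y hy
  -- the root child `x` of `b` precedes the new node `y`, but with `b` and `d` exchanged `y`
  -- precedes `x`
  have hxy := (hlt x y).2 ⟨⟨S, hS, sx, sy⟩, Or.inr (Or.inr ⟨hxb.2, hyV⟩)⟩
  have hyx := (hlt' y x).2 ⟨⟨S, hS, sy, sx⟩, Or.inr (Or.inr ⟨hyd.2, hxY⟩)⟩
  exact T.isOrdering.irrefl x (T.isOrdering.trans hS sx sy sx hxy hyx)

end BlockSystem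

theorem orderedTrees_uniqueDecomposition : orderedTrees.UniqueDecomposition :=
  BlockSystem.uniqueDecomposition fun t =>
    ⟨_, Or.inr ⟨t.root, t.root_mem, rfl⟩, fun _ hv => RTree.mem_roots_delRoot.1 hv⟩

theorem heapOrderedTrees_uniqueDecomposition : heapOrderedTrees.UniqueDecomposition :=
  BlockSystem.uniqueDecomposition fun t =>
    ⟨_, rfl, fun _ hv => (t.mem_of_parent (RTree.mem_roots_delRoot.1 hv)).1⟩

theorem generationOrderedTrees_uniqueDecomposition {n : ℕ} (hn : 2 ≤ n) :
    (generationOrderedTrees n).UniqueDecomposition :=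
  BlockSystem.uniqueDecomposition fun t =>
    ⟨_, Or.inl ⟨t.root, t.root_mem, rfl⟩, fun _ hv =>
      ⟨1, hn, t.root, rfl, RTree.mem_roots_delRoot.1 hv⟩⟩

/-! ### Unitriangular linear maps -/

/-- A linear map is bijective if it maps one basis to another up to terms of lower degree. -/
theorem bijective_of_unitriangular {k M N ι κ : Type*} [Field k] [AddCommGroup M] [Module k M]
    [AddCommGroup N] [Module k N] (b : Module.Basis ι k M) (b' : Module.Basis κ k N)
    (f : M →ₗ[k] N) (e : ι → κ) (he : Function.Bijective e) (deg : κ → ℕ)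
    (h : ∀ i, f (b i) - b' (e i) ∈ Submodule.span k (b' '' {j | deg j < deg (e i)})) :
    Function.Bijective f := by
  constructor
  · rw [injective_iff_map_eq_zero]
    intro x hx
    by_contra hne
    have hs : (b.repr x).support.Nonempty := by
      rw [Finsupp.support_nonempty_iff]
      simpa using hne
    -- the coefficient of `b' (e i)` in `f x`, for `i` of maximal degree, comes from `b i` alone
    obtain ⟨i, hi, hmax⟩ := Finset.exists_max_image _ (fun i => deg (e i)) hs
    have hcoord : ∀ j ∈ (b.repr x).support,
        b'.coord (e i) (f (b j)) = if j = i then 1 else 0 := by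
      intro j hj
      have h0 : b'.coord (e i) (f (b j) - b' (e j)) = 0 := by
        refine (Submodule.span_le (p := LinearMap.ker (b'.coord (e i)))).2 ?_ (h j)
        rintro _ ⟨c, hc, rfl⟩
        have hne' : c ≠ e i := by
          rintro rfl
          exact absurd (hmax j hj) (not_le.2 hc)
        simp [hne']
      rw [map_sub, sub_eq_zero] at h0
      rw [h0]
      simp [Finsupp.single_apply, he.1.eq_iff]
    have hsum := congrArg (fun y => b'.coord (e i) (f y)) (b.linearCombination_repr x)
    simp only [hx, map_zero, Finsupp.linearCombination_apply, Finsupp.sum, map_sum, map_smul]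
      at hsum
    rw [Finset.sum_eq_single_of_mem i hi (fun j hj hji => by rw [hcoord j hj, if_neg hji, smul_zero]),
      hcoord i hi, if_pos rfl, smul_eq_mul, mul_one] at hsum
    exact Finsupp.mem_support_iff.1 hi hsum
  · have hb : ∀ (n : ℕ) (j : κ), deg j < n → b' j ∈ LinearMap.range f := by
      intro n
      induction n with
      | zero => intro j hj; exact absurd hj (Nat.not_lt_zero _)
      | succ n ih =>
        intro j hj
        obtain ⟨i, rfl⟩ := he.2 j
        have h1 : f (b i) - b' (e i) ∈ LinearMap.range f := by
          refine Submodule.span_le.2 ?_ (h i)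
          rintro _ ⟨c, hc, rfl⟩
          exact ih c (lt_of_lt_of_le hc (Nat.lt_succ_iff.1 hj))
        have h2 := Submodule.sub_mem _ (LinearMap.mem_range_self f (b i)) h1
        rwa [sub_sub_cancel] at h2
    rw [← LinearMap.range_eq_top, eq_top_iff, ← b'.span_eq, Submodule.span_le]
    rintro _ ⟨j, rfl⟩
    exact hb _ j (Nat.lt_succ_self _)

namespace Family
variable {X : Family.{u}} (k : Type v) [Field k]

/-! ### Leading terms in the tree algebra -/

theorem treeBasis_mul_treeBasis (a b : X.Cls) :
    treeBasis X k a * treeBasis X k b = prodCls k a b := mulHom_basis k a b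

theorem treeBasis_unit : treeBasis X k X.unit = 1 := rfl

variable (X) in
/-- The span of the trees whose root has fewer than `n` children. -/
noncomputable def rootDegreeLT (n : ℕ) : Submodule k (TreeAlgebra k X) :=
  Submodule.span k (treeBasis X k '' {c | rootDegree c < n})

theorem rootDegreeLT_mono {m n : ℕ} (h : m ≤ n) : rootDegreeLT X k m ≤ rootDegreeLT X k n :=
  Submodule.span_mono (Set.image_mono fun _ hc => lt_of_lt_of_le hc h)

theorem treeBasis_mem_rootDegreeLT {n : ℕ} {c : X.Cls} (h : rootDegree c < n) :
    treeBasis X k c ∈ rootDegreeLT X k n :=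
  Submodule.subset_span ⟨c, h, rfl⟩

/-- The leading term of a product of trees is their `⊙`-product: every other link map sends some
tree to a node different from the root, so that the root gets fewer children. -/
theorem treeBasis_mul_sub_odot_mem (a b : X.Cls) :
    treeBasis X k a * treeBasis X k b - treeBasis X k (odot a b) ∈
      rootDegreeLT X k (rootDegree a + rootDegree b) := by
  obtain ⟨t₂, rfl, -⟩ := X.exists_rep_disjoint b ∅
  obtain ⟨t₁, rfl, h⟩ := X.exists_rep_disjoint a (X.under t₂).nodes
  have hl := disjoint_delRoot h.symm
  rw [treeBasis_mul_treeBasis, prodCls_eq k h, odot_eq h, linkSum]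
  set U := X.delRoot t₁ with hU
  -- link maps vanish off the roots of `U`, so the constant map has to be cut off
  set d₀ : ℕ → ℕ := fun v => if v ∈ (X.underF U).roots then (X.under t₂).root else 0 with hd₀
  have hmem : d₀ ∈ links (X.under t₂) (X.underF U) :=
    mem_links.2 ⟨fun v hv => by rw [hd₀]; simpa [hv] using (X.under t₂).root_mem,
      fun v hv => if_neg hv⟩
  rw [X.attach_congr t₂ U (fun _ => (X.under t₂).root) d₀ (isLink_root hl)
    (fun v hv => (if_pos hv).symm), ← Finset.add_sum_erase _ _ hmem, add_sub_cancel_left]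
  refine Submodule.sum_mem _ fun d hd => treeBasis_mem_rootDegreeLT k ?_
  obtain ⟨hne, hd⟩ := Finset.mem_erase.1 hd
  rw [mem_links] at hd
  rw [rootDegree_attach ⟨hl, hd.1⟩, add_comm, rootDegree_cls t₁]
  refine Nat.add_lt_add_right (Finset.card_lt_card (Finset.filter_ssubset.2 ?_)) _
  by_contra hall
  push Not at hall
  refine hne (funext fun v => ?_)
  by_cases hv : v ∈ (X.underF U).roots
  · rw [hall v hv, hd₀]
    exact (if_pos hv).symm
  · rw [hd.2 v hv, hd₀]
    exact (if_neg hv).symm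

theorem treeBasis_mul_mem {a : X.Cls} {n : ℕ} {y : TreeAlgebra k X}
    (hy : y ∈ rootDegreeLT X k n) :
    treeBasis X k a * y ∈ rootDegreeLT X k (rootDegree a + n) := by
  refine (Submodule.span_le (p := (rootDegreeLT X k (rootDegree a + n)).comap
    (LinearMap.mulLeft k (treeBasis X k a)))).2 ?_ hy
  rintro _ ⟨c, hc, rfl⟩
  have hc : rootDegree c < n := hc
  have h1 := rootDegreeLT_mono k (by omega : rootDegree a + rootDegree c ≤ rootDegree a + n)
    (treeBasis_mul_sub_odot_mem k a c)
  have h2 : treeBasis X k (odot a c) ∈ rootDegreeLT X k (rootDegree a + n) :=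
    treeBasis_mem_rootDegreeLT k (by rw [rootDegree_odot]; omega)
  have h3 := Submodule.add_mem _ h1 h2
  rwa [sub_add_cancel] at h3

theorem prod_treeBasis_sub_odotProd_mem (xs : List X.Indecomposables) :
    (xs.map fun x => treeBasis X k x.1).prod - treeBasis X k (odotProd xs) ∈
      rootDegreeLT X k (rootDegree (odotProd xs)) := by
  induction xs with
  | nil =>
    rw [odotProd_nil, treeBasis_unit, List.map_nil, List.prod_nil, sub_self]
    exact Submodule.zero_mem _
  | cons x xs ih =>
    rw [odotProd_cons, List.map_cons, List.prod_cons, rootDegree_odot]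
    have h := Submodule.add_mem _ (treeBasis_mul_mem k (a := x.1) ih)
      (treeBasis_mul_sub_odot_mem k x.1 (odotProd xs))
    rwa [mul_sub, sub_add_sub_cancel] at h

/-- The homomorphism from the free associative algebra on the indecomposable trees to the tree
algebra which is the identity on the indecomposable trees. -/
noncomputable def freeHom : FreeAlgebra k X.Indecomposables →ₐ[k] TreeAlgebra k X :=
  FreeAlgebra.lift k fun x : X.Indecomposables => treeBasis X k x.1

theorem freeHom_basisFreeMonoid (w : FreeMonoid X.Indecomposables) :
    freeHom k (FreeAlgebra.basisFreeMonoid k X.Indecomposables w) =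
      (w.toList.map fun x => treeBasis X k x.1).prod := by
  have h : FreeAlgebra.basisFreeMonoid k X.Indecomposables w =
      FreeMonoid.lift (FreeAlgebra.ι k) w := by
    change FreeAlgebra.equivMonoidAlgebraFreeMonoid.symm (MonoidAlgebra.single w 1) = _
    exact (MonoidAlgebra.lift_single _ _ _).trans (one_smul k _)
  rw [h, FreeMonoid.lift_apply, map_list_prod, List.map_map]
  congr 2
  funext x
  exact FreeAlgebra.lift_ι_apply _ x

theorem freeHom_bijective (h : X.UniqueDecomposition) :
    Function.Bijective (freeHom (X := X) k) := by
  refine bijective_of_unitriangular (FreeAlgebra.basisFreeMonoid k X.Indecomposables)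
    (treeBasis X k) (freeHom k).toLinearMap (fun w => odotProd w.toList)
    ⟨fun w w' hw => FreeMonoid.toList.injective (h _ _ hw), fun c => ?_⟩ rootDegree fun w => ?_
  · obtain ⟨xs, hx⟩ := odotProd_surjective c
    exact ⟨FreeMonoid.ofList xs, hx⟩
  · rw [AlgHom.toLinearMap_apply, freeHom_basisFreeMonoid]
    exact prod_treeBasis_sub_odotProd_mem k w.toList

end Family

end RootedTrees

theorem mainTheorem8 {k : Type v} [Field k] [CharZero k] :
    (∀ X : RootedTrees.Family.{u}, X.UniqueDecomposition →
      ∃ φ : FreeAlgebra k X.Indecomposables ≃ₐ[k] RootedTrees.Family.TreeAlgebra k X,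
        ∀ x : X.Indecomposables,
          φ (FreeAlgebra.ι k x) = RootedTrees.Family.treeBasis X k x.1) ∧
    RootedTrees.orderedTrees.UniqueDecomposition ∧
    RootedTrees.heapOrderedTrees.UniqueDecomposition ∧
    ∀ n : ℕ, 2 ≤ n → (RootedTrees.generationOrderedTrees n).UniqueDecomposition := by
  refine ⟨fun X h => ⟨AlgEquiv.ofBijective _ (RootedTrees.Family.freeHom_bijective k h), fun x => ?_⟩,
    RootedTrees.orderedTrees_uniqueDecomposition, RootedTrees.heapOrderedTrees_uniqueDecomposition,
    fun n hn => RootedTrees.generationOrderedTrees_uniqueDecomposition hn⟩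
  exact FreeAlgebra.lift_ι_apply _ x
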